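/- **Setting.** Let $x,t\in\mathbb R$, let $*$ denote (entrywise) complex conjugation, let $\sigma\in\{1,-1\}$, and put $\partial_x^{-1}=\frac12\big(\int_{-\infty}^x-\int_x^\infty\big)\,\cdot\,dx$. For complex functions $q,r$ of $(x,t)$ the AKNS$(-1)$ system is $$q_{xt}-2q\,\partial_x^{-1}(qr)_t=q,\qquad r_{xt}-2r\,\partial_x^{-1}(qr)_t=r, \tag{1}$$ or, with an auxiliary function $s$ (which is $s=\partial_x^{-1}(qr)_t+\frac12$ when the integral is used), $$q_{xt}=2qs,\qquad r_{xt}=2rs,\qquad s_x=(qr)_t. \tag{2}$$ The complex nonpotential sine-Gordon equation is $$q_{xt}-2qs=0,\qquad s_x+(|q|^2)_t=0, \tag{3}$$ and its nonlocal version is $$q_{xt}(x,t)-2q(x,t)s(x,t)=0,\qquad s_x(x,t)+[q(x,t)q^*(-x,-t)]_t=0. \tag{4}$$ In all equations $q$ and $r$ are of class $C^2$ and $s$ is differentiable in $x$. **Reduction of the system.** Let $r(x,t)=-q^*(\sigma x,\sigma t)$. (a) On any open set $\Omega$ of the $(x,t)$-plane invariant under $(x,t)\mapsto(\sigma x,\sigma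 t)$: if $(q,r,s)$ solves (2), then $(q,s)$ solves (3) when $\sigma=1$ and (4) when $\sigma=-1$. Conversely, if $(q,s)$ solves (3) (resp. (4)) and $s(\sigma x,\sigma t)=s^*(x,t)$, then $(q,r,s)$ solves (2). (b) If $q\in C^2(\mathbb R^2)$, $(qr)_t$ is integrable in $x$ for each $t$, and $s=\partial_x^{-1}(qr)_t+\frac12$, then $s(\sigma x,\sigma t)=s^*(x,t)$, and the following are equivalent: $(q,r)$ solves (1); $(q,r,s)$ solves (2); $(q,s)$ solves (3) when $\sigma=1$, (4) when $\sigma=-1$. **Solutions.** Let $n\ge0$, let $A\in\mathbb C^{2(n+1)\times2(n+1)}$ be invertible, let $C^\pm\in\mathbb C^{2(n+1)}$, and let $$\varphi=\exp\!\big(-Ax-\tfrac14A^{-1}t\big)C^+,\qquad \psi=\exp\!\big(Ax+\tfrac14A^{-1}t\big)C^- .$$ With $\widehat\varphi^{(j)}=(\varphi,\partial_x\varphi,\dots,\partial_x^j\varphi)$ (no columns if $j=-1$), and likewise $\widehat\psi^{(j)}$, put $$f=|\widehat\varphi^{(n)};\widehat\psi^{(n)}|,\quad g=2|\widehat\varphi^{(n+1)};\widehat\psi^{(n-1)}|,\quad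 h=2|\widehat\varphi^{(n-1)};\widehat\psi^{(n+1)}|.$$ Suppose that $T\in\mathbb C^{2(n+1)\times2(n+1)}$ satisfies $$AT+\sigma TA^*=0,\qquad TT^*=-\sigma I,\qquad C^-=TC^{+*}. \tag{5}$$ Then $\psi(x,t)=T\varphi^*(\sigma x,\sigma t)$. The open set $U=\{(x,t): f(x,t)\ne0\}$ is invariant under $(x,t)\mapsto(\sigma x,\sigma t)$, and on $U$ the functions $$q=\frac hf=\frac{2|\widehat\varphi^{(n-1)};\widehat\psi^{(n+1)}|}{|\widehat\varphi^{(n)};\widehat\psi^{(n)}|},\qquad r=-\frac gf,\qquad s=\frac12-(\ln f)_{xt}=\frac12-\frac{f f_{xt}-f_xf_t}{f^2}$$ satisfy $r(x,t)=-q^*(\sigma x,\sigma t)$ and $s(\sigma x,\sigma t)=s^*(x,t)$; $(q,r,s)$ solves (2), and $(q,s)$ solves (3) when $\sigma=1$ and (4) when $\sigma=-1$. If moreover $U=\mathbb R^2$ and, for each $t$, $(qr)_t$ is integrable in $x$ and $s\to\frac12$ as $x\to\pm\infty$, then $s=\partial_x^{-1}(qr)_t+\frac12$ and $(q,r)$ solves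 (1). **Explicit choices.** For every $\mathbf K\in\mathbb C^{(n+1)\times(n+1)}$ the block matrices $$A=\begin{pmatrix}\mathbf K&0\\0&-\mathbf K^*\end{pmatrix},\ T=\begin{pmatrix}0&-I\\I&0\end{pmatrix}\ (\sigma=1);\qquad A=\begin{pmatrix}\mathbf K&0\\0&\mathbf K^*\end{pmatrix},\ T=\begin{pmatrix}0&-I\\-I&0\end{pmatrix}\ (\sigma=-1)$$ satisfy $AT+\sigma TA^*=0$ and $TT^*=-\sigma I$, and $A$ is invertible if $\mathbf K$ is. Let $\mu(k)=-kx-\frac t{4k}$. If $\mathbf K=\mathrm{Diag}(k_1,\dots,k_{n+1})$ with all $k_j\ne0$, and $C^+=(c_1,\dots,c_{n+1},d_1,\dots,d_{n+1})^T$, then $$\varphi=(c_1e^{\mu(k_1)},\dots,c_{n+1}e^{\mu(k_{n+1})},d_1e^{\mu(-\sigma k_1^*)},\dots,d_{n+1}e^{\mu(-\sigma k_{n+1}^*)})^T.$$ If $\mathbf K$ is the lower triangular Jordan block with eigenvalue $k\ne0$ (with ones on the subdiagonal), $c$ and $d$ are functions (for instance constants) analytic near $k$ and $k^*$ respectively,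 and $C^+=\big(c,\frac{\partial_kc}{1!},\dots,\frac{\partial_k^nc}{n!},d,\frac{\partial_{k^*}d}{1!},\dots,\frac{\partial_{k^*}^nd}{n!}\big)^T$, then $$\varphi=\Big(ce^{\mu(k)},\tfrac{\partial_k}{1!}(ce^{\mu(k)}),\dots,\tfrac{\partial_k^n}{n!}(ce^{\mu(k)}),\,de^{\mu(-\sigma k^*)},\tfrac{\partial_{k^*}}{1!}(de^{\mu(-\sigma k^*)}),\dots,\tfrac{\partial_{k^*}^n}{n!}(de^{\mu(-\sigma k^*)})\Big)^T.$$ -/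

import Mathlib

open ComplexConjugate MeasureTheory Filter Topology

namespace AKNS

noncomputable section

/-! ### Differential and integral operators for functions of `(x, t)` -/

/-- `∂u/∂x`. -/
def dX (u : ℝ → ℝ → ℂ) : ℝ → ℝ → ℂ := fun x t => deriv (fun y => u y t) x

/-- `∂u/∂t`. -/
def dT (u : ℝ → ℝ → ℂ) : ℝ → ℝ → ℂ := fun x t => deriv (fun τ => u x τ) t

/-- `u_{xt}`: first differentiate in `x`, then in `t`. -/
def dXT (u : ℝ → ℝ → ℂ) : ℝ → ℝ → ℂ := dT (dX u)

/-- The operator `∂_x⁻¹ = (1/2) (∫_{-∞}^x - ∫_x^∞)`. -/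
def invDX (w : ℝ → ℂ) (x : ℝ) : ℂ :=
  (1 / 2) * ((∫ y in Set.Iic x, w y) - ∫ y in Set.Ioi x, w y)

/-- The pointwise product of two functions of `(x, t)`. -/
def prod (q r : ℝ → ℝ → ℂ) : ℝ → ℝ → ℂ := fun x t => q x t * r x t

/-! ### The AKNS(-1) system -/

/-- The AKNS(-1) system with an auxiliary function `s` on the open set `Ω` of the `(x, t)`-plane:
`q_{xt} = 2 q s`, `r_{xt} = 2 r s`, `s_x = (q r)_t`, with `q`, `r` of class `C²` on `Ω`. -/
structure IsSolution (Ω : Set (ℝ × ℝ)) (q r s : ℝ → ℝ → ℂ) : Prop where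
  smooth_q : ContDiffOn ℝ 2 (Function.uncurry q) Ω
  smooth_r : ContDiffOn ℝ 2 (Function.uncurry r) Ω
  differentiable_s : ∀ x t, (x, t) ∈ Ω → DifferentiableAt ℝ (fun y => s y t) x
  eq_q : ∀ x t, (x, t) ∈ Ω → dXT q x t = 2 * q x t * s x t
  eq_r : ∀ x t, (x, t) ∈ Ω → dXT r x t = 2 * r x t * s x t
  eq_s : ∀ x t, (x, t) ∈ Ω → dX s x t = dT (prod q r) x t

/-- The AKNS(-1) system in integral form on the whole plane:
`q_{xt} - 2 q ∂_x⁻¹ (q r)_t = q`, `r_{xt} - 2 r ∂_x⁻¹ (q r)_t = r`,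
with `q`, `r` of class `C²` and `(q r)_t` integrable in `x` for each `t`. -/
structure IsIntegralSolution (q r : ℝ → ℝ → ℂ) : Prop where
  smooth_q : ContDiff ℝ 2 (Function.uncurry q)
  smooth_r : ContDiff ℝ 2 (Function.uncurry r)
  integrable : ∀ t, Integrable (fun x => dT (prod q r) x t)
  eq_q : ∀ x t, dXT q x t - 2 * q x t * invDX (fun y => dT (prod q r) y t) x = q x t
  eq_r : ∀ x t, dXT r x t - 2 * r x t * invDX (fun y => dT (prod q r) y t) x = r x t

/-! ### The complex reduction and the reduced equations -/

/-- `r(x, t) = - q*(σ x, σ t)`. -/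
def reduction (σ : ℝ) (q : ℝ → ℝ → ℂ) : ℝ → ℝ → ℂ := fun x t => -conj (q (σ * x) (σ * t))

/-- The complex nonpotential sine-Gordon equation on the open set `Ω`:
`q_{xt} - 2 q s = 0`, `s_x + (|q|²)_t = 0`. -/
structure IsComplexSG (Ω : Set (ℝ × ℝ)) (q s : ℝ → ℝ → ℂ) : Prop where
  smooth_q : ContDiffOn ℝ 2 (Function.uncurry q) Ω
  differentiable_s : ∀ x t, (x, t) ∈ Ω → DifferentiableAt ℝ (fun y => s y t) x
  eq_q : ∀ x t, (x, t) ∈ Ω → dXT q x t - 2 * q x t * s x t = 0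
  eq_s : ∀ x t, (x, t) ∈ Ω →
    dX s x t + dT (fun y τ => ((‖q y τ‖ ^ 2 : ℝ) : ℂ)) x t = 0

/-- The nonlocal complex nonpotential sine-Gordon equation on the open set `Ω`
(symmetric under `(x, t) ↦ (-x, -t)`):
`q_{xt} - 2 q s = 0`, `s_x + [q(x, t) q*(-x, -t)]_t = 0`. -/
structure IsNonlocalComplexSG (Ω : Set (ℝ × ℝ)) (q s : ℝ → ℝ → ℂ) : Prop where
  smooth_q : ContDiffOn ℝ 2 (Function.uncurry q) Ω
  differentiable_s : ∀ x t, (x, t) ∈ Ω → DifferentiableAt ℝ (fun y => s y t) x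
  eq_q : ∀ x t, (x, t) ∈ Ω → dXT q x t - 2 * q x t * s x t = 0
  eq_s : ∀ x t, (x, t) ∈ Ω →
    dX s x t + dT (fun y τ => q y τ * conj (q (-y) (-τ))) x t = 0

/-- The reduced equation belonging to `σ`: the complex nonpotential sine-Gordon equation for
`σ = 1`, its nonlocal version for `σ = -1`. -/
def IsReducedSG (σ : ℝ) (Ω : Set (ℝ × ℝ)) (q s : ℝ → ℝ → ℂ) : Prop :=
  (σ = 1 → IsComplexSG Ω q s) ∧ (σ = -1 → IsNonlocalComplexSG Ω q s)

/-! ### Double Wronskians -/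

/-- The double Wronskian `|φ, ∂_x φ, …, ∂_x^{a-1} φ; ψ, ∂_x ψ, …, ∂_x^{N-a-1} ψ|` of two vectors
of length `N`. -/
def dblWronskian {N : ℕ} (a : ℕ) (φ ψ : ℝ → ℝ → Fin N → ℂ) (x t : ℝ) : ℂ :=
  Matrix.det (Matrix.of fun i j : Fin N =>
    if (j : ℕ) < a then iteratedDeriv (j : ℕ) (fun y => φ y t i) x
    else iteratedDeriv ((j : ℕ) - a) (fun y => ψ y t i) x)

/-- Vectors of length `2(n+1)`. -/
abbrev Vec (n : ℕ) : Type := Fin ((n + 1) + (n + 1)) → ℂ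

/-- Complex matrices of size `2(n+1) × 2(n+1)`. -/
abbrev Mat (n : ℕ) : Type := Matrix (Fin ((n + 1) + (n + 1))) (Fin ((n + 1) + (n + 1))) ℂ

/-- `φ = exp(-A x - (1/4) A⁻¹ t) C⁺`. -/
def phi {n : ℕ} (A : Mat n) (Cp : Vec n) (x t : ℝ) : Vec n :=
  (NormedSpace.exp (-((x : ℂ) • A) - ((t : ℂ) / 4) • A⁻¹)).mulVec Cp

/-- `ψ = exp(A x + (1/4) A⁻¹ t) C⁻`. -/
def psi {n : ℕ} (A : Mat n) (Cm : Vec n) (x t : ℝ) : Vec n :=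
  (NormedSpace.exp ((x : ℂ) • A + ((t : ℂ) / 4) • A⁻¹)).mulVec Cm

/-- Entrywise complex conjugate of a vector. -/
def conjVec {n : ℕ} (v : Vec n) : Vec n := fun i => conj (v i)

/-- The constraints on `T` and `A`: `A T + σ T A* = 0` and `T T* = -σ I`, where `*` is the
entrywise complex conjugate. -/
def Constraint {n : ℕ} (σ : ℝ) (A T : Mat n) : Prop :=
  A * T + (σ : ℂ) • (T * A.map conj) = 0 ∧ T * T.map conj = (-(σ : ℂ)) • (1 : Mat n)

/-- `f = |φ^(n); ψ^(n)|`. -/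
def wf {n : ℕ} (A : Mat n) (Cp Cm : Vec n) : ℝ → ℝ → ℂ :=
  dblWronskian (n + 1) (phi A Cp) (psi A Cm)

/-- `g = 2 |φ^(n+1); ψ^(n-1)|`. -/
def wg {n : ℕ} (A : Mat n) (Cp Cm : Vec n) : ℝ → ℝ → ℂ :=
  fun x t => 2 * dblWronskian (n + 2) (phi A Cp) (psi A Cm) x t

/-- `h = 2 |φ^(n-1); ψ^(n+1)|`. -/
def wh {n : ℕ} (A : Mat n) (Cp Cm : Vec n) : ℝ → ℝ → ℂ :=
  fun x t => 2 * dblWronskian n (phi A Cp) (psi A Cm) x t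

/-- `q = h / f`. -/
def wq {n : ℕ} (A : Mat n) (Cp Cm : Vec n) : ℝ → ℝ → ℂ :=
  fun x t => wh A Cp Cm x t / wf A Cp Cm x t

/-- `r = - g / f`. -/
def wr {n : ℕ} (A : Mat n) (Cp Cm : Vec n) : ℝ → ℝ → ℂ :=
  fun x t => -(wg A Cp Cm x t / wf A Cp Cm x t)

/-- The auxiliary function `s = 1/2 - (ln f)_{xt} = 1/2 - (f f_{xt} - f_x f_t) / f²`. -/
def ws {n : ℕ} (A : Mat n) (Cp Cm : Vec n) : ℝ → ℝ → ℂ := fun x t =>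
  1 / 2 - (wf A Cp Cm x t * dXT (wf A Cp Cm) x t - dX (wf A Cp Cm) x t * dT (wf A Cp Cm) x t)
    / wf A Cp Cm x t ^ 2

/-- The points of the `(x, t)`-plane where `f` does not vanish. -/
def regularSet {n : ℕ} (A : Mat n) (Cp Cm : Vec n) : Set (ℝ × ℝ) :=
  {p | wf A Cp Cm p.1 p.2 ≠ 0}

/-! ### Explicit block solutions -/

/-- A `2(n+1) × 2(n+1)` matrix from its four `(n+1) × (n+1)` blocks. -/
def blocks {n : ℕ} (X Y Z W : Matrix (Fin (n + 1)) (Fin (n + 1)) ℂ) : Mat n :=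
  Matrix.reindex finSumFinEquiv finSumFinEquiv (Matrix.fromBlocks X Y Z W)

/-- The block matrix `T`: `T₁ = T₄ = 0`, `T₂ = -I`, `T₃ = σ I`, that is, `T₃ = -T₂ = I` for
`σ = 1` and `T₃ = T₂ = -I` for `σ = -1`. -/
def blockT (n : ℕ) (σ : ℝ) : Mat n := blocks 0 (-1) ((σ : ℂ) • 1) 0

/-- The block matrix `A`: `K₁ = K`, `K₄ = -σ K*`, that is, `K₁ = -K₄* = K` for
`σ = 1` and `K₁ = K₄* = K` for `σ = -1`. -/
def blockA {n : ℕ} (σ : ℝ) (K : Matrix (Fin (n + 1)) (Fin (n + 1)) ℂ) : Mat n :=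
  blocks K 0 0 (-((σ : ℂ) • K.map conj))

/-- `μ(k) = -k x - t / (4 k)`. -/
def mu (k : ℂ) (x t : ℝ) : ℂ := -k * x - t / (4 * k)

/-- The lower triangular Jordan block `J_{n+1}(k)`. -/
def jordan (n : ℕ) (k : ℂ) : Matrix (Fin (n + 1)) (Fin (n + 1)) ℂ :=
  Matrix.of fun i j => if i = j then k else if (i : ℕ) = (j : ℕ) + 1 then 1 else 0

/-- The vector `(u, ∂u / 1!, …, ∂ⁿu / n!)` of scaled derivatives of `u` at `k`. -/
def jet (n : ℕ) (u : ℂ → ℂ) (k : ℂ) : Fin (n + 1) → ℂ :=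
  fun j => iteratedDeriv (j : ℕ) u k / ((j : ℕ).factorial : ℂ)

end

end AKNS

namespace AKNS

/-! ### Reflection and complex conjugation -/

/-! The reduction rests on one observation: if r(x,t) = -q*(σx,σt), the equation for r is the
conjugated and reflected equation for q. Two derivatives produce σ² = 1, and s must be invariant
under conjugation with reflection. In the integral form this invariance is automatic, because the
product qr has it and `invDX` respects it.

For the Wronskian solutions, no determinant identities are used. Let W be the matrix with f = det W
(`wronskianMatrix`) and S = Diag(-1,…,-1,1,…,1). Since φ and ψ are exponentials with opposite
exponents, W_x = A W S and W_t = (1/4) A⁻¹ W S. The matrix K = W⁻¹ W_x (`companion`) therefore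
satisfies the closed equations K_x = K S K S - K² and K_t = (1/4)(1 - S K⁻¹ S K). Apart from two
columns K is a shift, so these equations descend to two 2×2 blocks: U (`lastBlock`) and b
(`firstBlock`), with b_x = b X, X = sUs - U, s = Diag(-1,1), and U_t = (1/4)(1 - s b⁻¹ s b).
Eliminating b gives U_tx = -X/2 + X U_t + U_t X (`hasEntryDeriv_lastBlockT_fst`). By Cramer's rule q
and r are 2(-1)^(n+1) times the off-diagonal entries of U (`wq_eq`, `wr_eq`), and by Jacobi's
formula (ln f)_x = tr U, so the auxiliary function is 1/2 - tr U_t (`ws_eq`). Read entrywise, the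
2×2 equation is the AKNS(-1) system.

The constraint on T intertwines the exponents, so W(x,t) = T W*(σx,σt) J with J a signed exchange of
the two column blocks (`wronskianMatrix_symm`). Determinants give the symmetry of f, hence of s; the
induced relation J K = σ K*(σx,σt) J gives r = -q*(σx,σt).

The explicit vectors φ are found by exhibiting a curve v with v' = P v, so that exp(P) v(0) = v(1).
For a Jordan block, the block acts on jets as multiplication by the spectral variable. -/

lemma dT_neg (u : ℝ → ℝ → ℂ) (x t : ℝ) : dT (fun y τ => -u y τ) x t = -dT u x t :=
  deriv.fun_neg

lemma dX_const_mul (c : ℂ) (u : ℝ → ℝ → ℂ) : dX (fun y τ => c * u y τ) = fun x t => c * dX u x t := by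
  ext x t
  exact deriv_const_mul_field c

lemma dT_const_mul (c : ℂ) (u : ℝ → ℝ → ℂ) : dT (fun y τ => c * u y τ) = fun x t => c * dT u x t := by
  ext x t
  exact deriv_const_mul_field c

lemma dX_conj_comp (σ : ℝ) (u : ℝ → ℝ → ℂ) :
    dX (fun y τ => conj (u (σ * y) (σ * τ))) = fun x t => σ * conj (dX u (σ * x) (σ * t)) := by
  ext x t
  have h := deriv_comp_mul_left σ (fun y => conj (u y (σ * t))) x
  simp only [dX]
  rw [h, Complex.real_smul]
  congr 1
  exact deriv.star (f := fun y => u y (σ * t)) (x := σ * x)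

lemma dT_conj_comp (σ : ℝ) (u : ℝ → ℝ → ℂ) :
    dT (fun y τ => conj (u (σ * y) (σ * τ))) = fun x t => σ * conj (dT u (σ * x) (σ * t)) := by
  ext x t
  have h := deriv_comp_mul_left σ (fun y => conj (u (σ * x) y)) t
  simp only [dT]
  rw [h, Complex.real_smul]
  congr 1
  exact deriv.star (f := fun y => u (σ * x) y) (x := σ * t)

lemma dXT_conj_comp (σ : ℝ) (u : ℝ → ℝ → ℂ) (x t : ℝ) :
    dXT (fun y τ => conj (u (σ * y) (σ * τ))) x t = σ ^ 2 * conj (dXT u (σ * x) (σ * t)) := by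
  unfold dXT
  rw [dX_conj_comp, dT_const_mul, dT_conj_comp]
  ring

lemma dXT_const_mul (c : ℂ) (u : ℝ → ℝ → ℂ) (x t : ℝ) :
    dXT (fun y τ => c * u y τ) x t = c * dXT u x t := by
  unfold dXT
  rw [dX_const_mul, dT_const_mul]

lemma sq_eq_one_of_sign {σ : ℝ} (hσ : σ = 1 ∨ σ = -1) : (σ : ℂ) ^ 2 = 1 := by
  rcases hσ with rfl | rfl <;> simp

lemma mul_self_of_sign {σ : ℝ} (hσ : σ = 1 ∨ σ = -1) (x : ℝ) : σ * (σ * x) = x := by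
  rcases hσ with rfl | rfl <;> simp

lemma dXT_reduction {σ : ℝ} (hσ : σ = 1 ∨ σ = -1) (q : ℝ → ℝ → ℂ) (x t : ℝ) :
    dXT (reduction σ q) x t = -conj (dXT q (σ * x) (σ * t)) := by
  have h : reduction σ q = fun x t => (-1 : ℂ) * conj (q (σ * x) (σ * t)) := by
    ext x t; simp [reduction]
  rw [h, dXT_const_mul, dXT_conj_comp, sq_eq_one_of_sign hσ]
  ring

lemma contDiffOn_reduction {σ : ℝ} {Ω : Set (ℝ × ℝ)}
    (hΩ : ∀ x t, (x, t) ∈ Ω → (σ * x, σ * t) ∈ Ω) {q : ℝ → ℝ → ℂ}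
    (hq : ContDiffOn ℝ 2 (Function.uncurry q) Ω) :
    ContDiffOn ℝ 2 (Function.uncurry (reduction σ q)) Ω := by
  have h1 : ContDiffOn ℝ 2 (fun p : ℝ × ℝ => Function.uncurry q (σ * p.1, σ * p.2)) Ω :=
    hq.comp (t := Ω) (f := fun p : ℝ × ℝ => (σ * p.1, σ * p.2)) (by fun_prop)
      (fun p hp => hΩ p.1 p.2 hp)
  exact (Complex.conjCLE.contDiff.comp_contDiffOn h1).neg

/-- Only the equations for `q` and `s` of the system are needed for the reduced equation. -/
lemma isReducedSG_of_eqs {σ : ℝ} {Ω : Set (ℝ × ℝ)} {q s : ℝ → ℝ → ℂ}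
    (smooth_q : ContDiffOn ℝ 2 (Function.uncurry q) Ω)
    (diff_s : ∀ x t, (x, t) ∈ Ω → DifferentiableAt ℝ (fun y => s y t) x)
    (eq_q : ∀ x t, (x, t) ∈ Ω → dXT q x t = 2 * q x t * s x t)
    (eq_s : ∀ x t, (x, t) ∈ Ω → dX s x t = dT (prod q (reduction σ q)) x t) :
    IsReducedSG σ Ω q s := by
  constructor
  · rintro rfl
    refine ⟨smooth_q, diff_s, fun x t h => by rw [eq_q x t h, sub_self], fun x t h => ?_⟩
    rw [eq_s x t h, show prod q (reduction 1 q) = fun y τ => -((‖q y τ‖ ^ 2 : ℝ) : ℂ) by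
      ext y τ; simp [prod, reduction, Complex.mul_conj'], dT_neg]
    ring
  · rintro rfl
    refine ⟨smooth_q, diff_s, fun x t h => by rw [eq_q x t h, sub_self], fun x t h => ?_⟩
    rw [eq_s x t h, show prod q (reduction (-1) q) = fun y τ => -(q y τ * conj (q (-y) (-τ))) by
      ext y τ; simp [prod, reduction], dT_neg]
    ring

lemma eqs_of_isReducedSG {σ : ℝ} (hσ : σ = 1 ∨ σ = -1) {Ω : Set (ℝ × ℝ)} {q s : ℝ → ℝ → ℂ}
    (h : IsReducedSG σ Ω q s) :
    ContDiffOn ℝ 2 (Function.uncurry q) Ω ∧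
    (∀ x t, (x, t) ∈ Ω → DifferentiableAt ℝ (fun y => s y t) x) ∧
    (∀ x t, (x, t) ∈ Ω → dXT q x t = 2 * q x t * s x t) ∧
    (∀ x t, (x, t) ∈ Ω → dX s x t = dT (prod q (reduction σ q)) x t) := by
  rcases hσ with rfl | rfl
  · obtain ⟨h1, h2, h3, h4⟩ := h.1 rfl
    refine ⟨h1, h2, fun x t hx => sub_eq_zero.1 (h3 x t hx), fun x t hx => ?_⟩
    rw [show prod q (reduction 1 q) = fun y τ => -((‖q y τ‖ ^ 2 : ℝ) : ℂ) by
      ext y τ; simp [prod, reduction, Complex.mul_conj'], dT_neg]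
    linear_combination h4 x t hx
  · obtain ⟨h1, h2, h3, h4⟩ := h.2 rfl
    refine ⟨h1, h2, fun x t hx => sub_eq_zero.1 (h3 x t hx), fun x t hx => ?_⟩
    rw [show prod q (reduction (-1) q) = fun y τ => -(q y τ * conj (q (-y) (-τ))) by
      ext y τ; simp [prod, reduction], dT_neg]
    linear_combination h4 x t hx

lemma IsSolution.isReducedSG {σ : ℝ} {Ω : Set (ℝ × ℝ)} {q s : ℝ → ℝ → ℂ}
    (h : IsSolution Ω q (reduction σ q) s) : IsReducedSG σ Ω q s :=
  isReducedSG_of_eqs h.smooth_q h.differentiable_s h.eq_q h.eq_s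

/-- The missing equation for r is the conjugate of the one for q at the reflected point; the
symmetry of s brings the coefficient back to (x,t). -/
lemma IsReducedSG.isSolution {σ : ℝ} (hσ : σ = 1 ∨ σ = -1) {Ω : Set (ℝ × ℝ)} {q s : ℝ → ℝ → ℂ}
    (hΩ : ∀ x t, (x, t) ∈ Ω → (σ * x, σ * t) ∈ Ω)
    (hs : ∀ x t, (x, t) ∈ Ω → s (σ * x) (σ * t) = conj (s x t))
    (h : IsReducedSG σ Ω q s) : IsSolution Ω q (reduction σ q) s := by
  obtain ⟨h1, h2, h3, h4⟩ := eqs_of_isReducedSG hσ h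
  refine ⟨h1, contDiffOn_reduction hΩ h1, h2, h3, fun x t hx => ?_, h4⟩
  rw [dXT_reduction hσ, h3 _ _ (hΩ x t hx), hs x t hx]
  simp only [reduction, map_mul, Complex.conj_conj, map_ofNat]
  ring

/-! ### The integral operator `∂_x⁻¹` -/

/-- Up to an additive constant, `invDX w` is the primitive of w starting at 0. -/
lemma hasDerivAt_invDX {w : ℝ → ℂ} (hw : Integrable w) (hc : Continuous w) (x : ℝ) :
    HasDerivAt (invDX w) (w x) x := by
  have h : invDX w = fun x => (∫ y in Set.Iic 0, w y) + (∫ y in (0 : ℝ)..x, w y)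
      - (1 / 2) * ∫ y, w y := by
    ext x
    have h1 := intervalIntegral.integral_Iic_sub_Iic (a := 0) (b := x) (μ := volume)
      hw.integrableOn hw.integrableOn
    have h2 := intervalIntegral.integral_Iic_add_Ioi (b := x) (μ := volume)
      hw.integrableOn hw.integrableOn
    unfold invDX
    rw [← h1, ← h2]
    ring
  rw [h]
  exact ((hc.integral_hasStrictDerivAt 0 x).hasDerivAt.const_add _).sub_const _

/-- The two half-line integrals are u x - c and c - u x, so half their difference is u x - c; the
limits at both ends must agree. -/
lemma invDX_eq_of_tendsto {u w : ℝ → ℂ} {c : ℂ} (hu : ∀ x, HasDerivAt u (w x) x)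
    (hw : Integrable w) (hbot : Tendsto u atBot (𝓝 c)) (htop : Tendsto u atTop (𝓝 c)) (x : ℝ) :
    u x = invDX w x + c := by
  have h1 := integral_Iic_of_hasDerivAt_of_tendsto' (a := x) (fun y _ => hu y) hw.integrableOn hbot
  have h2 := integral_Ioi_of_hasDerivAt_of_tendsto' (a := x) (fun y _ => hu y) hw.integrableOn htop
  unfold invDX
  rw [h1, h2]
  ring

lemma invDX_conj (w : ℝ → ℂ) (x : ℝ) : invDX (fun y => conj (w y)) x = conj (invDX w x) := by
  unfold invDX
  rw [integral_conj, integral_conj]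
  simp only [map_mul, map_sub, map_div₀, map_one, map_ofNat]

/-- The substitution y ↦ -y exchanges the two half-lines, and the minus sign compensates for their
order. -/
lemma invDX_neg_comp_neg (w : ℝ → ℂ) (x : ℝ) : invDX (fun y => -w (-y)) x = invDX w (-x) := by
  unfold invDX
  rw [integral_neg, integral_neg, integral_comp_neg_Iic, integral_comp_neg_Ioi]
  ring

/-! ### The system in integral form -/

lemma hasDerivAt_fst {E : Type*} [NormedAddCommGroup E] [NormedSpace ℝ E] {F : ℝ × ℝ → E} {x t : ℝ}
    (hF : DifferentiableAt ℝ F (x, t)) :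
    HasDerivAt (fun y => F (y, t)) (fderiv ℝ F (x, t) (1, 0)) x :=
  HasFDerivAt.comp_hasDerivAt (f := fun y => (y, t)) x hF.hasFDerivAt
    ((hasDerivAt_id x).prodMk (hasDerivAt_const x t))

lemma hasDerivAt_snd {E : Type*} [NormedAddCommGroup E] [NormedSpace ℝ E] {F : ℝ × ℝ → E} {x t : ℝ}
    (hF : DifferentiableAt ℝ F (x, t)) :
    HasDerivAt (fun τ => F (x, τ)) (fderiv ℝ F (x, t) (0, 1)) t :=
  HasFDerivAt.comp_hasDerivAt (f := fun τ => (x, τ)) t hF.hasFDerivAt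
    ((hasDerivAt_const t x).prodMk (hasDerivAt_id t))

lemma continuous_dT {u : ℝ → ℝ → ℂ} (hu : ContDiff ℝ 2 (Function.uncurry u)) (t : ℝ) :
    Continuous fun x => dT u x t := by
  have h : (fun x => dT u x t) = fun x => fderiv ℝ (Function.uncurry u) (x, t) (0, 1) := by
    ext x
    exact (hasDerivAt_snd (hu.differentiable (by norm_num) _)).deriv
  rw [h]
  have := hu.continuous_fderiv (by norm_num)
  fun_prop

/-- Mixed second derivatives of `C²` functions are symmetric. -/
lemma dXT_eq_dX_dT {u : ℝ → ℝ → ℂ} {x t : ℝ} (hu : ContDiffAt ℝ 2 (Function.uncurry u) (x, t)) :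
    dXT u x t = dX (dT u) x t := by
  set F := Function.uncurry u
  have hsym := (hu.isSymmSndFDerivAt (by simp)).eq (1, 0) (0, 1)
  have hd : ∀ᶠ p in 𝓝 (x, t), DifferentiableAt ℝ F p :=
    (hu.eventually (by simp)).mono fun p hp => hp.differentiableAt (by norm_num)
  have hF : DifferentiableAt ℝ (fderiv ℝ F) (x, t) :=
    (hu.fderiv_right (m := 1) (by norm_num)).differentiableAt (by norm_num)
  have h1 : (fun τ => dX u x τ) =ᶠ[𝓝 t] fun τ => fderiv ℝ F (x, τ) (1, 0) := by
    have : Tendsto (fun τ : ℝ => (x, τ)) (𝓝 t) (𝓝 (x, t)) := by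
      exact (by fun_prop : Continuous fun τ : ℝ => (x, τ)).tendsto t
    filter_upwards [this.eventually hd] with τ hτ
    exact (hasDerivAt_fst hτ).deriv
  have h2 : (fun y => dT u y t) =ᶠ[𝓝 x] fun y => fderiv ℝ F (y, t) (0, 1) := by
    have : Tendsto (fun y : ℝ => (y, t)) (𝓝 x) (𝓝 (x, t)) := by
      exact (by fun_prop : Continuous fun y : ℝ => (y, t)).tendsto x
    filter_upwards [this.eventually hd] with τ hτ
    exact (hasDerivAt_snd hτ).deriv
  have h3 : HasDerivAt (fun τ => fderiv ℝ F (x, τ) (1, 0))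
      (fderiv ℝ (fderiv ℝ F) (x, t) (0, 1) (1, 0)) t :=
    (ContinuousLinearMap.apply ℝ ℂ ((1, 0) : ℝ × ℝ)).hasFDerivAt.comp_hasDerivAt t
      (hasDerivAt_snd hF)
  have h4 : HasDerivAt (fun y => fderiv ℝ F (y, t) (0, 1))
      (fderiv ℝ (fderiv ℝ F) (x, t) (1, 0) (0, 1)) x :=
    (ContinuousLinearMap.apply ℝ ℂ ((0, 1) : ℝ × ℝ)).hasFDerivAt.comp_hasDerivAt x
      (hasDerivAt_fst hF)
  have e1 : dXT u x t = fderiv ℝ (fderiv ℝ F) (x, t) (0, 1) (1, 0) := by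
    unfold dXT
    rw [dT, h1.deriv_eq, h3.deriv]
  have e2 : dX (dT u) x t = fderiv ℝ (fderiv ℝ F) (x, t) (1, 0) (0, 1) := by
    rw [dX, h2.deriv_eq, h4.deriv]
  rw [e1, e2, hsym]

/-- With s the shifted primitive, the first two equations of both forms differ only by algebra, and
the third holds by differentiating the primitive. -/
lemma isIntegralSolution_iff_isSolution {q r s : ℝ → ℝ → ℂ}
    (hq : ContDiff ℝ 2 (Function.uncurry q)) (hr : ContDiff ℝ 2 (Function.uncurry r))
    (hi : ∀ t, Integrable (fun x => dT (prod q r) x t))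
    (hs : ∀ x t, s x t = invDX (fun y => dT (prod q r) y t) x + 1 / 2) :
    IsIntegralSolution q r ↔ IsSolution Set.univ q r s := by
  have hd : ∀ x t, HasDerivAt (fun y => s y t) (dT (prod q r) x t) x := fun x t => by
    have := (hasDerivAt_invDX (hi t) (continuous_dT (u := prod q r) (hq.mul hr) t) x).add_const (1 / 2)
    exact this.congr_of_eventuallyEq (Eventually.of_forall fun y => hs y t)
  constructor
  · intro h
    refine ⟨hq.contDiffOn, hr.contDiffOn, fun x t _ => (hd x t).differentiableAt,
      fun x t _ => ?_, fun x t _ => ?_, fun x t _ => (hd x t).deriv⟩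
    · rw [hs]; linear_combination h.eq_q x t
    · rw [hs]; linear_combination h.eq_r x t
  · intro h
    refine ⟨hq, hr, hi, fun x t => ?_, fun x t => ?_⟩
    · have := h.eq_q x t trivial
      rw [hs] at this; linear_combination this
    · have := h.eq_r x t trivial
      rw [hs] at this; linear_combination this

/-- The product qr is invariant under reflection followed by conjugation, so its t-derivative gains
a factor σ. For σ = -1 this sign is absorbed by `invDX_neg_comp_neg`. -/
lemma invDX_reduction_symm {σ : ℝ} (hσ : σ = 1 ∨ σ = -1) (q : ℝ → ℝ → ℂ) (x t : ℝ) :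
    invDX (fun y => dT (prod q (reduction σ q)) y (σ * t)) (σ * x) =
      conj (invDX (fun y => dT (prod q (reduction σ q)) y t) x) := by
  have hp : prod q (reduction σ q) =
      fun y τ => conj (prod q (reduction σ q) (σ * y) (σ * τ)) := by
    ext y τ
    simp only [prod, reduction, mul_self_of_sign hσ]
    simp [mul_comm]
  have hw : ∀ y τ, dT (prod q (reduction σ q)) y τ =
      σ * conj (dT (prod q (reduction σ q)) (σ * y) (σ * τ)) := fun y τ => by
    conv_lhs => rw [hp, dT_conj_comp]
  rw [← invDX_conj]
  rcases hσ with rfl | rfl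
  · simp only [one_mul]
    congr 1
    ext y
    have := hw y t
    simpa using this
  · simp only [neg_one_mul]
    rw [← invDX_neg_comp_neg]
    congr 1
    ext y
    have := hw y t
    rw [this]
    simp

lemma integral_form {σ : ℝ} (hσ : σ = 1 ∨ σ = -1) (q s : ℝ → ℝ → ℂ)
    (hq : ContDiff ℝ 2 (Function.uncurry q))
    (hi : ∀ t, Integrable (fun x => dT (prod q (reduction σ q)) x t))
    (hs : ∀ x t, s x t = invDX (fun y => dT (prod q (reduction σ q)) y t) x + 1 / 2) :
    (∀ x t, s (σ * x) (σ * t) = conj (s x t)) ∧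
    (IsIntegralSolution q (reduction σ q) ↔ IsSolution Set.univ q (reduction σ q) s) ∧
    (IsIntegralSolution q (reduction σ q) ↔ IsReducedSG σ Set.univ q s) := by
  have hsym : ∀ x t, s (σ * x) (σ * t) = conj (s x t) := fun x t => by
    rw [hs, hs, invDX_reduction_symm hσ]
    simp only [map_add, map_div₀, map_one, map_ofNat]
  have hr : ContDiff ℝ 2 (Function.uncurry (reduction σ q)) :=
    contDiffOn_univ.1 (contDiffOn_reduction (by simp) hq.contDiffOn)
  have h1 := isIntegralSolution_iff_isSolution hq hr hi hs
  exact ⟨hsym, h1, h1.trans ⟨fun h => h.isReducedSG,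
    fun h => h.isSolution hσ (by simp) fun x t _ => hsym x t⟩⟩

/-! ### Matrix exponentials and linear differential equations -/

lemma hasDerivAt_exp_real_smul {N : ℕ} (P : Matrix (Fin N) (Fin N) ℂ) (s : ℝ) (i j : Fin N) :
    HasDerivAt (fun s : ℝ => NormedSpace.exp (s • P) i j)
      ((P * NormedSpace.exp (s • P)) i j) s := by
  -- A submultiplicative norm is chosen inside the proof only; the entrywise conclusion does not
  -- depend on it.
  let : NormedRing (Matrix (Fin N) (Fin N) ℂ) := Matrix.linftyOpNormedRing
  let : NormedAlgebra ℝ (Matrix (Fin N) (Fin N) ℂ) := Matrix.linftyOpNormedAlgebra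
  have h := hasDerivAt_exp_smul_const' (𝕂 := ℝ) P s
  exact hasDerivAt_pi.1 (hasDerivAt_pi.1 h i) j

lemma hasDerivAt_mulVec {ι κ : Type*} [Fintype ι] [Fintype κ] {F : ℝ → Matrix ι κ ℂ}
    {F' : Matrix ι κ ℂ} {v : ℝ → κ → ℂ} {v' : κ → ℂ} {s : ℝ}
    (hF : ∀ i j, HasDerivAt (fun s => F s i j) (F' i j) s)
    (hv : ∀ j, HasDerivAt (fun s => v s j) (v' j) s) (i : ι) :
    HasDerivAt (fun s => (F s).mulVec (v s) i) ((F'.mulVec (v s) + (F s).mulVec v') i) s := by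
  have := HasDerivAt.fun_sum (u := Finset.univ) fun j _ => (hF i j).mul (hv j)
  refine this.congr_deriv ?_
  simp [Matrix.mulVec, dotProduct, Finset.sum_add_distrib]

/-- The solution of `v' = P v` is `v(s) = exp(s P) v(0)`. -/
lemma exp_mulVec_eq_of_hasDerivAt {N : ℕ} (P : Matrix (Fin N) (Fin N) ℂ) (v : ℝ → Fin N → ℂ)
    (hv : ∀ s i, HasDerivAt (fun s => v s i) (P.mulVec (v s) i) s) :
    (NormedSpace.exp P).mulVec (v 0) = v 1 := by
  -- The curve exp(-sP) v(s) has zero derivative, hence is constant.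
  have key : ∀ s, (NormedSpace.exp (s • -P)).mulVec (v s) = v 0 := fun s => by
    ext i
    have hd : ∀ s, HasDerivAt (fun s : ℝ => (NormedSpace.exp (s • -P)).mulVec (v s) i) 0 s := by
      intro s
      refine (hasDerivAt_mulVec (F := fun s : ℝ => NormedSpace.exp (s • -P))
        (hasDerivAt_exp_real_smul (-P) s) (hv s) i).congr_deriv ?_
      have hc : Commute (-P) (NormedSpace.exp (s • -P)) := by
        let : NormedRing (Matrix (Fin N) (Fin N) ℂ) := Matrix.linftyOpNormedRing
        let : NormedAlgebra ℚ (Matrix (Fin N) (Fin N) ℂ) := Matrix.linftyOpNormedAlgebra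
        exact ((Commute.refl (-P)).smul_right s).exp_right
      rw [hc.eq, ← Matrix.mulVec_mulVec, ← Matrix.mulVec_add]
      simp [Matrix.neg_mulVec]
    have := is_const_of_deriv_eq_zero (fun s => (hd s).differentiableAt) (fun s => (hd s).deriv) s 0
    simpa using this
  rw [← key 1, Matrix.mulVec_mulVec, one_smul, Matrix.exp_neg, Matrix.mul_nonsing_inv, Matrix.one_mulVec]
  exact (Matrix.isUnit_iff_isUnit_det _).1 (Matrix.isUnit_exp P)

/-- Here s runs along the segment from the origin to (x,t). The curve w plays the role of A⁻¹ v, so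
no inverse matrix has to be computed. -/
lemma phi_eq_of_hasDerivAt {n : ℕ} (A : Mat n) (v w : ℝ → Vec n) (hA : IsUnit A.det) (x t : ℝ)
    (hw : ∀ s, A.mulVec (w s) = v s)
    (hv : ∀ s i, HasDerivAt (fun s => v s i)
      (-(x * A.mulVec (v s) i) - t / 4 * w s i) s) :
    phi A (v 0) x t = v 1 := by
  refine exp_mulVec_eq_of_hasDerivAt _ v fun s i => (hv s i).congr_deriv ?_
  have h : (A⁻¹).mulVec (v s) = w s := by
    rw [← hw s, Matrix.mulVec_mulVec, Matrix.nonsing_inv_mul _ hA, Matrix.one_mulVec]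
  simp [Matrix.sub_mulVec, Matrix.neg_mulVec, Matrix.smul_mulVec, h]

/-! ### Block matrices -/

lemma append_comp_finSumFinEquiv {m k : ℕ} (u : Fin m → ℂ) (w : Fin k → ℂ) :
    Fin.append u w ∘ finSumFinEquiv = Sum.elim u w := by
  ext i
  cases i <;> simp

lemma blocks_mulVec_append {n : ℕ} (X Y Z W : Matrix (Fin (n + 1)) (Fin (n + 1)) ℂ)
    (u w : Fin (n + 1) → ℂ) :
    (blocks X Y Z W).mulVec (Fin.append u w) =
      Fin.append (X.mulVec u + Y.mulVec w) (Z.mulVec u + W.mulVec w) := by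
  have h : Fin.append u w = Sum.elim u w ∘ finSumFinEquiv.symm := by
    rw [← append_comp_finSumFinEquiv, Function.comp_assoc, Equiv.self_comp_symm, Function.comp_id]
  rw [blocks, Matrix.reindex_apply, Matrix.submatrix_mulVec_equiv, h, Equiv.symm_symm,
    Function.comp_assoc, Equiv.symm_comp_self, Function.comp_id, Matrix.fromBlocks_mulVec,
    ← append_comp_finSumFinEquiv, Function.comp_assoc, Equiv.self_comp_symm, Function.comp_id]
  simp

lemma blockA_mulVec_append {n : ℕ} (σ : ℝ) (K : Matrix (Fin (n + 1)) (Fin (n + 1)) ℂ)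
    (u w : Fin (n + 1) → ℂ) :
    (blockA σ K).mulVec (Fin.append u w) =
      Fin.append (K.mulVec u) (-((σ : ℂ) • (K.map conj).mulVec w)) := by
  simp [blockA, blocks_mulVec_append, Matrix.neg_mulVec, Matrix.smul_mulVec]

lemma blocks_mul {n : ℕ} (X Y Z W X' Y' Z' W' : Matrix (Fin (n + 1)) (Fin (n + 1)) ℂ) :
    blocks X Y Z W * blocks X' Y' Z' W' =
      blocks (X * X' + Y * Z') (X * Y' + Y * W') (Z * X' + W * Z') (Z * Y' + W * W') := by
  simp only [blocks, Matrix.reindex_apply, Matrix.submatrix_mul_equiv, Matrix.fromBlocks_multiply]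

lemma blocks_map_conj {n : ℕ} (X Y Z W : Matrix (Fin (n + 1)) (Fin (n + 1)) ℂ) :
    (blocks X Y Z W).map conj = blocks (X.map conj) (Y.map conj) (Z.map conj) (W.map conj) := by
  simp only [blocks, Matrix.reindex_apply, ← Matrix.submatrix_map, Matrix.fromBlocks_map]

lemma blocks_add {n : ℕ} (X Y Z W X' Y' Z' W' : Matrix (Fin (n + 1)) (Fin (n + 1)) ℂ) :
    blocks X Y Z W + blocks X' Y' Z' W' = blocks (X + X') (Y + Y') (Z + Z') (W + W') := by
  simp only [blocks, Matrix.reindex_apply, ← Matrix.fromBlocks_add]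
  rfl

lemma smul_blocks {n : ℕ} (c : ℂ) (X Y Z W : Matrix (Fin (n + 1)) (Fin (n + 1)) ℂ) :
    c • blocks X Y Z W = blocks (c • X) (c • Y) (c • Z) (c • W) := by
  simp only [blocks, Matrix.reindex_apply, ← Matrix.fromBlocks_smul]
  rfl

lemma blocks_zero {n : ℕ} : (blocks 0 0 0 0 : Mat n) = 0 := by
  simp [blocks]

lemma blocks_one {n : ℕ} : (blocks 1 0 0 1 : Mat n) = 1 := by
  simp [blocks]

lemma map_conj_map_conj {ι κ : Type*} (K : Matrix ι κ ℂ) : (K.map conj).map conj = K := by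
  ext i j
  simp

lemma map_conj_real_smul {ι κ : Type*} (σ : ℝ) (K : Matrix ι κ ℂ) :
    ((σ : ℂ) • K).map conj = (σ : ℂ) • K.map conj := by
  ext i j
  simp

lemma map_conj_neg {ι κ : Type*} (K : Matrix ι κ ℂ) : (-K).map conj = -K.map conj := by
  ext i j
  simp

lemma map_conj_one {ι : Type*} [DecidableEq ι] : (1 : Matrix ι ι ℂ).map conj = 1 :=
  Matrix.map_one _ (map_zero _) (map_one _)

lemma map_conj_zero {ι κ : Type*} : (0 : Matrix ι κ ℂ).map conj = 0 :=
  Matrix.map_zero _ (map_zero _)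

lemma constraint_blocks {σ : ℝ} (hσ : σ = 1 ∨ σ = -1) {n : ℕ}
    (K : Matrix (Fin (n + 1)) (Fin (n + 1)) ℂ) : Constraint σ (blockA σ K) (blockT n σ) := by
  have h2 : σ * σ = 1 := by rcases hσ with rfl | rfl <;> simp
  constructor
  · simp only [blockA, blockT, blocks_map_conj, blocks_mul, smul_blocks, blocks_add,
      map_conj_zero, map_conj_neg, map_conj_real_smul, map_conj_map_conj]
    simp [smul_smul, h2, blocks_zero]
  · simp only [blockT, blocks_map_conj, blocks_mul, map_conj_zero, map_conj_neg, map_conj_real_smul,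
      map_conj_one]
    rw [← blocks_one, smul_blocks]
    simp

lemma isUnit_det_map_conj {ι : Type*} [Fintype ι] [DecidableEq ι] {K : Matrix ι ι ℂ}
    (hK : IsUnit K.det) : IsUnit (K.map conj).det := by
  have : (K.map conj).det = conj K.det := (RingHom.map_det _ _).symm
  rw [this]
  exact hK.map _

lemma isUnit_det_blockA {σ : ℝ} (hσ : σ = 1 ∨ σ = -1) {n : ℕ}
    {K : Matrix (Fin (n + 1)) (Fin (n + 1)) ℂ} (hK : IsUnit K.det) : IsUnit (blockA σ K).det := by
  have hs : IsUnit (-(σ : ℂ)) := by rcases hσ with rfl | rfl <;> simp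
  rw [blockA, blocks, Matrix.det_reindex_self, Matrix.det_fromBlocks_zero₂₁, ← neg_smul,
    Matrix.det_smul]
  exact hK.mul ((hs.pow _).mul (isUnit_det_map_conj hK))

/-! ### Explicit `φ` for a diagonal matrix -/

lemma hasDerivAt_exp_real_mul (c m : ℂ) (s : ℝ) :
    HasDerivAt (fun s : ℝ => c * Complex.exp (s * m)) (m * (c * Complex.exp (s * m))) s := by
  have := ((Complex.ofRealCLM.hasDerivAt (x := s)).mul_const m).cexp.const_mul c
  refine this.congr_deriv ?_
  simp
  ring

lemma forall_fin_append {m k : ℕ} {p : Fin (m + k) → Prop} :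
    (∀ i, p i) ↔ (∀ i, p (Fin.castAdd k i)) ∧ ∀ i, p (Fin.natAdd m i) :=
  ⟨fun h => ⟨fun _ => h _, fun _ => h _⟩, fun h i => Fin.addCases h.1 h.2 i⟩

/-- The curve joining the initial vector to the claimed one multiplies every exponent by s; w
divides the entries by the eigenvalues k_j and -σ k_j*. -/
lemma phi_diagonal {σ : ℝ} (hσ : σ = 1 ∨ σ = -1) {n : ℕ} (k c d : Fin (n + 1) → ℂ)
    (hk : ∀ j, k j ≠ 0) (x t : ℝ) :
    phi (blockA σ (Matrix.diagonal k)) (Fin.append c d) x t =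
      Fin.append (fun j => c j * Complex.exp (mu (k j) x t))
        (fun j => d j * Complex.exp (mu (-(σ : ℂ) * conj (k j)) x t)) := by
  have hs : (σ : ℂ) ≠ 0 := by rcases hσ with rfl | rfl <;> simp
  have hk' : ∀ j, conj (k j) ≠ 0 := fun j => by simpa using hk j
  have hA : IsUnit (blockA σ (Matrix.diagonal k)).det := by
    refine isUnit_det_blockA hσ ?_
    rw [Matrix.det_diagonal, isUnit_iff_ne_zero]
    exact Finset.prod_ne_zero_iff.2 fun j _ => hk j
  have hm : (Matrix.diagonal k).map conj = Matrix.diagonal fun j => conj (k j) :=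
    Matrix.diagonal_map (map_zero _)
  have := phi_eq_of_hasDerivAt (blockA σ (Matrix.diagonal k))
    (fun s => Fin.append (fun j => c j * Complex.exp (s * mu (k j) x t))
        (fun j => d j * Complex.exp (s * mu (-(σ : ℂ) * conj (k j)) x t)))
    (fun s => Fin.append (fun j => (k j)⁻¹ * (c j * Complex.exp (s * mu (k j) x t)))
        (fun j => (-(σ : ℂ) * conj (k j))⁻¹ *
          (d j * Complex.exp (s * mu (-(σ : ℂ) * conj (k j)) x t)))) hA x t ?_ ?_
  · simpa using this
  · intro s
    rw [blockA_mulVec_append, hm]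
    refine funext (forall_fin_append.2 ⟨fun j => ?_, fun j => ?_⟩)
    · simp [Matrix.mulVec_diagonal, hk j]
    · simp only [Fin.append_right, Pi.neg_apply, Pi.smul_apply, Matrix.mulVec_diagonal, smul_eq_mul]
      field_simp [hk' j]
  · intro s
    simp only [blockA_mulVec_append, hm]
    refine forall_fin_append.2 ⟨fun j => ?_, fun j => ?_⟩
    · simp only [Fin.append_left, Matrix.mulVec_diagonal]
      refine (hasDerivAt_exp_real_mul _ _ _).congr_deriv ?_
      have := hk j
      simp only [mu]
      field_simp
    · simp only [Fin.append_right, Pi.neg_apply, Pi.smul_apply, Matrix.mulVec_diagonal, smul_eq_mul]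
      refine (hasDerivAt_exp_real_mul _ _ _).congr_deriv ?_
      have := hk' j
      simp only [mu]
      field_simp

/-! ### Explicit `φ` for a Jordan block -/

lemma iteratedDeriv_add_at {f g : ℂ → ℂ} {k : ℂ} (hf : AnalyticAt ℂ f k) (hg : AnalyticAt ℂ g k)
    (j : ℕ) : iteratedDeriv j (fun z => f z + g z) k = iteratedDeriv j f k + iteratedDeriv j g k :=
  iteratedDeriv_fun_add (hf.contDiffAt) (hg.contDiffAt)

/-- Leibniz' rule with a factor z, only whose first derivative survives; the induction uses (z u)' =
u + z u' and therefore quantifies over u. -/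
lemma iteratedDeriv_id_mul {k : ℂ} (j : ℕ) : ∀ {u : ℂ → ℂ}, AnalyticAt ℂ u k →
    iteratedDeriv (j + 1) (fun z => z * u z) k =
      k * iteratedDeriv (j + 1) u k + (j + 1) * iteratedDeriv j u k := by
  have hder : ∀ {u : ℂ → ℂ}, AnalyticAt ℂ u k →
      deriv (fun z => z * u z) =ᶠ[𝓝 k] fun z => u z + z * deriv u z := fun {u} hu => by
    filter_upwards [hu.eventually_analyticAt] with z hz
    have := (hasDerivAt_id z).fun_mul hz.differentiableAt.hasDerivAt
    simpa using this.deriv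
  induction j with
  | zero =>
    intro u hu
    have := (hder hu).eq_of_nhds
    simp [iteratedDeriv_one, this]
    ring
  | succ j ih =>
    intro u hu
    have hid : AnalyticAt ℂ (fun z : ℂ => z) k := analyticAt_id
    rw [iteratedDeriv_succ', (hder hu).iteratedDeriv_eq,
      iteratedDeriv_add_at hu (hid.fun_mul hu.deriv), ih hu.deriv, ← iteratedDeriv_succ',
      ← iteratedDeriv_succ']
    push_cast
    ring

/-- The factor j + 1 from Leibniz' rule is cancelled by the factorials, leaving the ones of the
subdiagonal: the Jordan block is multiplication by z on jets. -/
lemma jordan_mulVec_jet (n : ℕ) {k : ℂ} {u : ℂ → ℂ} (hu : AnalyticAt ℂ u k) :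
    (jordan n k).mulVec (jet n u k) = jet n (fun z => z * u z) k := by
  ext i
  have h : ∀ j, jordan n k i j * jet n u k j = (if i = j then k * jet n u k j else 0) +
      if (i : ℕ) = (j : ℕ) + 1 then jet n u k j else 0 := by
    intro j
    by_cases h1 : i = j
    · subst h1; simp [jordan]
    · simp [jordan, h1]
  simp only [Matrix.mulVec, dotProduct, h, Finset.sum_add_distrib, Finset.sum_ite_eq,
    Finset.mem_univ, if_true]
  rcases Fin.eq_zero_or_eq_succ i with rfl | ⟨i', rfl⟩
  · simp [jet]
  · rw [Finset.sum_eq_single i'.castSucc]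
    · simp only [jet, Fin.val_succ, Fin.val_castSucc, if_true, iteratedDeriv_id_mul _ hu]
      have : ((i' : ℕ) + 1 : ℂ) ≠ 0 := by exact_mod_cast Nat.succ_ne_zero i'
      have h' : ((i' : ℕ).factorial : ℂ) ≠ 0 := by exact_mod_cast Nat.factorial_ne_zero i'
      rw [Nat.factorial_succ]
      push_cast
      field_simp
    · intro b _ hb
      rw [if_neg]
      intro hc
      apply hb
      ext
      simp at hc ⊢
      omega
    · simp

lemma jordan_map_conj (n : ℕ) (k : ℂ) : (jordan n k).map conj = jordan n (conj k) := by
  ext i j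
  simp only [jordan, Matrix.map_apply, Matrix.of_apply]
  split_ifs <;> simp

lemma isUnit_det_jordan (n : ℕ) {k : ℂ} (hk : k ≠ 0) : IsUnit (jordan n k).det := by
  rw [Matrix.det_of_isLowerTriangular, isUnit_iff_ne_zero]
  · simp [jordan, hk]
  · intro i j hij
    have hij : i < j := hij
    have h1 : (i : ℕ) < j := hij
    simp only [jordan, Matrix.of_apply]
    rw [if_neg hij.ne, if_neg (by omega)]

/-- Differentiation in the parameter `s` commutes with iterated differentiation of
`u(κ) exp(s m(κ))`. -/
lemma hasDerivAt_iteratedDeriv_mul_exp {k : ℂ} {m : ℂ → ℂ} (hm : AnalyticAt ℂ m k) (j : ℕ) :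
    ∀ {u : ℂ → ℂ}, AnalyticAt ℂ u k → ∀ s : ℝ,
      HasDerivAt (fun s : ℝ => iteratedDeriv j (fun z => u z * Complex.exp (s * m z)) k)
        (iteratedDeriv j (fun z => m z * u z * Complex.exp (s * m z)) k) s := by
  have hexp : ∀ s : ℝ, AnalyticAt ℂ (fun z => Complex.exp (s * m z)) k := fun s =>
    (analyticAt_const.mul hm).cexp
  have hder : ∀ (j : ℕ) {u : ℂ → ℂ}, AnalyticAt ℂ u k → ∀ s : ℝ,
      iteratedDeriv j (deriv fun z => u z * Complex.exp (s * m z)) k =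
        iteratedDeriv j (fun z => deriv u z * Complex.exp (s * m z)) k +
          s * iteratedDeriv j (fun z => deriv m z * u z * Complex.exp (s * m z)) k := by
    intro j u hu s
    have h : deriv (fun z => u z * Complex.exp (s * m z)) =ᶠ[𝓝 k] fun z =>
        deriv u z * Complex.exp (s * m z) +
          s * (deriv m z * u z * Complex.exp (s * m z)) := by
      filter_upwards [hu.eventually_analyticAt, hm.eventually_analyticAt] with z hz hmz
      have := hz.differentiableAt.hasDerivAt.fun_mul
        ((hmz.differentiableAt.hasDerivAt.const_mul (s : ℂ)).cexp)
      rw [this.deriv]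
      ring
    rw [h.iteratedDeriv_eq, iteratedDeriv_add_at (hu.deriv.fun_mul (hexp s))
      (analyticAt_const.fun_mul ((hm.deriv.fun_mul hu).fun_mul (hexp s))), iteratedDeriv_const_mul_field]
  induction j with
  | zero =>
    intro u hu s
    simp only [iteratedDeriv_zero]
    refine (hasDerivAt_exp_real_mul (u k) (m k) s).congr_deriv (by ring)
  | succ j ih =>
    intro u hu s
    -- Carrying out one z-derivative first turns u into u' and s m' u, to which the induction
    -- hypothesis applies; the explicit factor s then contributes through the product rule.
    have h1 : (fun s : ℝ => iteratedDeriv (j + 1) (fun z => u z * Complex.exp (s * m z)) k) =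
        fun s : ℝ => iteratedDeriv j (fun z => deriv u z * Complex.exp (s * m z)) k +
          s * iteratedDeriv j (fun z => deriv m z * u z * Complex.exp (s * m z)) k := by
      ext s
      rw [iteratedDeriv_succ', hder j hu]
    have h2 : (fun z => deriv (fun z => m z * u z) z * Complex.exp (s * m z)) =ᶠ[𝓝 k] fun z =>
        m z * deriv u z * Complex.exp (s * m z) + deriv m z * u z * Complex.exp (s * m z) := by
      filter_upwards [hu.eventually_analyticAt, hm.eventually_analyticAt] with z hz hmz
      rw [(hmz.differentiableAt.hasDerivAt.fun_mul hz.differentiableAt.hasDerivAt).deriv]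
      ring
    rw [h1, iteratedDeriv_succ', hder j (hm.fun_mul hu), h2.iteratedDeriv_eq,
      iteratedDeriv_add_at ((hm.fun_mul hu.deriv).fun_mul (hexp s))
        ((hm.deriv.fun_mul hu).fun_mul (hexp s))]
    refine ((ih hu.deriv s).add ((Complex.ofRealCLM.hasDerivAt (x := s)).mul
      (ih (hm.deriv.fun_mul hu) s))).congr_deriv ?_
    have h3 : (fun z => m z * (deriv m z * u z) * Complex.exp (s * m z)) =
        fun z => deriv m z * (m z * u z) * Complex.exp (s * m z) := by
      ext z; ring
    rw [h3]
    simp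
    ring

lemma jet_smul (n : ℕ) (c : ℂ) (f : ℂ → ℂ) (k : ℂ) :
    jet n (fun z => c * f z) k = c • jet n f k := by
  ext i
  simp [jet, mul_div_assoc]

lemma jet_congr (n : ℕ) {f g : ℂ → ℂ} {k : ℂ} (h : f =ᶠ[𝓝 k] g) : jet n f k = jet n g k := by
  ext i
  simp [jet, h.iteratedDeriv_eq]

lemma jet_add (n : ℕ) {f g : ℂ → ℂ} {k : ℂ} (hf : AnalyticAt ℂ f k) (hg : AnalyticAt ℂ g k) :
    jet n (fun z => f z + g z) k = jet n f k + jet n g k := by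
  ext i
  simp [jet, iteratedDeriv_add_at hf hg, add_div]

/-- The jet of `u(κ) exp(s μ(b κ))` solves the linear equation with the Jordan block `b J`. -/
lemma hasDerivAt_jet (n : ℕ) {k b : ℂ} (hk : k ≠ 0) (hb : b ≠ 0) {u : ℂ → ℂ}
    (hu : AnalyticAt ℂ u k) (x t s : ℝ) (i : Fin (n + 1)) :
    HasDerivAt (fun s : ℝ => jet n (fun z => u z * Complex.exp (s * mu (b * z) x t)) k i)
      (-(x * (b * jet n (fun z => z * (u z * Complex.exp (s * mu (b * z) x t))) k i)) -
        t / 4 * jet n (fun z => (b * z)⁻¹ * (u z * Complex.exp (s * mu (b * z) x t))) k i) s := by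
  have hinv : AnalyticAt ℂ (fun z => (b * z)⁻¹) k :=
    (analyticAt_const.fun_mul analyticAt_id).fun_inv (mul_ne_zero hb hk)
  have hmu : AnalyticAt ℂ (fun z => mu (b * z) x t) k := by
    have h : (fun z => mu (b * z) x t) = fun z => -(x * b) * z + -(t / 4) * (b * z)⁻¹ := by
      ext z
      simp only [mu, div_eq_mul_inv, mul_inv]
      ring
    rw [h]
    exact (analyticAt_const.fun_mul analyticAt_id).fun_add (analyticAt_const.fun_mul hinv)
  have hue : AnalyticAt ℂ (fun z => u z * Complex.exp (s * mu (b * z) x t)) k :=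
    hu.fun_mul (analyticAt_const.fun_mul hmu).cexp
  have h1 : jet n (fun z => mu (b * z) x t * u z * Complex.exp (s * mu (b * z) x t)) k =
      (-(x * b) : ℂ) • jet n (fun z => z * (u z * Complex.exp (s * mu (b * z) x t))) k +
      (-(t / 4) : ℂ) •
        jet n (fun z => (b * z)⁻¹ * (u z * Complex.exp (s * mu (b * z) x t))) k := by
    have hid : AnalyticAt ℂ (fun z : ℂ => z) k := analyticAt_id
    rw [← jet_smul, ← jet_smul, ← jet_add n (analyticAt_const.fun_mul (hid.fun_mul hue))
      (analyticAt_const.fun_mul (hinv.fun_mul hue))]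
    congr 1
    ext z
    simp only [mu, div_eq_mul_inv, mul_inv]
    ring
  have h2 := (hasDerivAt_iteratedDeriv_mul_exp hmu i hu s).div_const ((i : ℕ).factorial : ℂ)
  refine h2.congr_deriv ?_
  have := congrFun h1 i
  simp only [jet, Pi.add_apply, Pi.smul_apply, smul_eq_mul] at this ⊢
  rw [this]
  ring

/-- On jets, the diagonal blocks of A act as multiplication by b z with b = 1 and b = -σ, and their
inverses as multiplication by (b z)⁻¹, which is analytic because k ≠ 0. -/
lemma phi_jordan {σ : ℝ} (hσ : σ = 1 ∨ σ = -1) (n : ℕ) {k : ℂ} {c d : ℂ → ℂ} (hk : k ≠ 0)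
    (hc : AnalyticAt ℂ c k) (hd : AnalyticAt ℂ d (conj k)) (x t : ℝ) :
    phi (blockA σ (jordan n k)) (Fin.append (jet n c k) (jet n d (conj k))) x t =
      Fin.append (jet n (fun κ => c κ * Complex.exp (mu κ x t)) k)
        (jet n (fun κ => d κ * Complex.exp (mu (-(σ : ℂ) * κ) x t)) (conj k)) := by
  have hs : -(σ : ℂ) ≠ 0 := by rcases hσ with rfl | rfl <;> simp
  have hk' : conj k ≠ 0 := by simpa using hk
  have hmu : ∀ {b l : ℂ}, b ≠ 0 → l ≠ 0 → ∀ {u : ℂ → ℂ}, AnalyticAt ℂ u l → ∀ s : ℝ,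
      AnalyticAt ℂ (fun z => u z * Complex.exp (s * mu (b * z) x t)) l := by
    intro b l hb hl u hu s
    have h4 : (4 * (b * l)) ≠ 0 := by simp [hb, hl]
    unfold mu
    fun_prop (disch := exact h4)
  have hinv : ∀ {b l : ℂ}, b ≠ 0 → l ≠ 0 → ∀ {u : ℂ → ℂ}, AnalyticAt ℂ u l →
      AnalyticAt ℂ (fun z => (b * z)⁻¹ * u z) l ∧
      b • jet n (fun z => z * ((b * z)⁻¹ * u z)) l = jet n u l := by
    intro b l hb hl u hu
    refine ⟨((analyticAt_const.fun_mul analyticAt_id).fun_inv (mul_ne_zero hb hl)).fun_mul hu, ?_⟩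
    rw [← jet_smul]
    refine jet_congr n ?_
    filter_upwards [isOpen_ne.mem_nhds hl] with z hz
    have hz : z ≠ 0 := hz
    field_simp
  have := phi_eq_of_hasDerivAt (blockA σ (jordan n k))
    -- The factor `1 * z` gives the upper block the form b z of the lower one, so that
    -- `hasDerivAt_jet` serves both.
    (fun s => Fin.append (jet n (fun z => c z * Complex.exp (s * mu (1 * z) x t)) k)
      (jet n (fun z => d z * Complex.exp (s * mu (-(σ : ℂ) * z) x t)) (conj k)))
    (fun s => Fin.append
      (jet n (fun z => (1 * z)⁻¹ * (c z * Complex.exp (s * mu (1 * z) x t))) k)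
      (jet n (fun z => (-(σ : ℂ) * z)⁻¹ * (d z * Complex.exp (s * mu (-(σ : ℂ) * z) x t))) (conj k)))
    (isUnit_det_blockA hσ (isUnit_det_jordan n hk)) x t ?_ ?_
  · simpa using this
  · intro s
    obtain ⟨h1, h2⟩ := hinv one_ne_zero hk (hmu one_ne_zero hk hc s)
    obtain ⟨h3, h4⟩ := hinv hs hk' (hmu hs hk' hd s)
    rw [blockA_mulVec_append, jordan_map_conj, jordan_mulVec_jet n h1, jordan_mulVec_jet n h3,
      ← neg_smul, h4]
    rw [one_smul] at h2
    rw [h2]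
  · intro s
    have h1 := hmu one_ne_zero hk hc s
    have h3 := hmu hs hk' hd s
    simp only [blockA_mulVec_append, jordan_map_conj, jordan_mulVec_jet n h1,
      jordan_mulVec_jet n h3, ← neg_smul]
    refine forall_fin_append.2 ⟨fun j => ?_, fun j => ?_⟩
    · simp only [Fin.append_left]
      exact (hasDerivAt_jet n hk one_ne_zero hc x t s j).congr_deriv (by simp)
    · simp only [Fin.append_right]
      exact (hasDerivAt_jet n hk' hs hd x t s j).congr_deriv (by simp)

/-! ### Entrywise derivatives of matrix-valued functions -/

/-- The entries of `F` have the entries of `F'` as derivatives at `s`. -/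
def HasEntryDeriv {ι κ : Type*} (F : ℝ → Matrix ι κ ℂ) (F' : Matrix ι κ ℂ) (s : ℝ) : Prop :=
  ∀ i j, HasDerivAt (fun s => F s i j) (F' i j) s

namespace HasEntryDeriv

variable {ι κ μ : Type*} {F G : ℝ → Matrix ι κ ℂ} {F' G' : Matrix ι κ ℂ} {s : ℝ}

lemma congr (h : HasEntryDeriv F F' s) (e : F' = G') : HasEntryDeriv F G' s := e ▸ h

lemma const (M : Matrix ι κ ℂ) : HasEntryDeriv (fun _ => M) 0 s := fun _ _ => hasDerivAt_const _ _

lemma sub (hF : HasEntryDeriv F F' s) (hG : HasEntryDeriv G G' s) :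
    HasEntryDeriv (fun s => F s - G s) (F' - G') s := fun i j => (hF i j).sub (hG i j)

lemma const_smul (c : ℂ) (hF : HasEntryDeriv F F' s) :
    HasEntryDeriv (fun s => c • F s) (c • F') s := fun i j => (hF i j).const_mul c

lemma submatrix {ι' κ' : Type*} (hF : HasEntryDeriv F F' s) (a : ι' → ι) (b : κ' → κ) :
    HasEntryDeriv (fun s => (F s).submatrix a b) (F'.submatrix a b) s := fun i j => hF (a i) (b j)

lemma mul [Fintype κ] {H : ℝ → Matrix κ μ ℂ} {H' : Matrix κ μ ℂ} (hF : HasEntryDeriv F F' s)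
    (hH : HasEntryDeriv H H' s) :
    HasEntryDeriv (fun s => F s * H s) (F' * H s + F s * H') s := fun i j => by
  have := HasDerivAt.fun_sum (u := Finset.univ) fun k _ => (hF i k).mul (hH k j)
  refine this.congr_deriv ?_
  simp [Matrix.mul_apply, Finset.sum_add_distrib]

lemma const_mul [Fintype κ] {H : ℝ → Matrix κ μ ℂ} {H' : Matrix κ μ ℂ} (M : Matrix ι κ ℂ)
    (hH : HasEntryDeriv H H' s) : HasEntryDeriv (fun s => M * H s) (M * H') s :=
  ((const M).mul hH).congr (by simp)

lemma mul_const [Fintype κ] (hF : HasEntryDeriv F F' s) (M : Matrix κ μ ℂ) :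
    HasEntryDeriv (fun s => F s * M) (F' * M) s :=
  (hF.mul (const M)).congr (by simp)

lemma inv [Fintype ι] [DecidableEq ι] {F : ℝ → Matrix ι ι ℂ} {F' : Matrix ι ι ℂ}
    (hF : HasEntryDeriv F F' s) (h : IsUnit (F s).det) :
    HasEntryDeriv (fun s => (F s)⁻¹) (-((F s)⁻¹ * F' * (F s)⁻¹)) s := by
  let _ : NormedRing (Matrix ι ι ℂ) := Matrix.linftyOpNormedRing
  let _ : NormedAlgebra ℝ (Matrix ι ι ℂ) := Matrix.linftyOpNormedAlgebra
  have : CompleteSpace (Matrix ι ι ℂ) := inferInstanceAs (CompleteSpace (ι → ι → ℂ))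
  obtain ⟨u, hu⟩ := (Matrix.isUnit_iff_isUnit_det _).2 h
  have h1 : HasDerivAt F F' s := hasDerivAt_pi.2 fun i => hasDerivAt_pi.2 fun j => hF i j
  have h2 : HasFDerivAt Ring.inverse _ (F s) := hu ▸ hasFDerivAt_ringInverse (𝕜 := ℝ) u
  have h3 := h2.comp_hasDerivAt s h1
  intro i j
  have h4 := hasDerivAt_pi.1 (hasDerivAt_pi.1 h3 i) j
  simp only [Matrix.nonsing_inv_eq_ringInverse]
  refine h4.congr_deriv ?_
  rw [← hu, Ring.inverse_unit]
  simp

/-- Jacobi's formula. -/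
lemma det [Fintype ι] [DecidableEq ι] {F : ℝ → Matrix ι ι ℂ} {F' : Matrix ι ι ℂ}
    (hF : HasEntryDeriv F F' s) :
    HasDerivAt (fun s => (F s).det) (((F s).adjugate * F').trace) s := by
  -- By Cramer's rule the trace is the sum of the determinants with one column differentiated.
  have h1 : ((F s).adjugate * F').trace = ∑ i, ((F s).updateCol i fun k => F' k i).det := by
    simp only [Matrix.trace, Matrix.diag]
    refine Finset.sum_congr rfl fun i _ => ?_
    rw [← Matrix.cramer_apply, Matrix.cramer_eq_adjugate_mulVec]
    rfl
  rw [h1]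
  simp only [Matrix.det_apply]
  rw [Finset.sum_comm]
  refine HasDerivAt.fun_sum fun p _ => ?_
  have h2 := (HasDerivAt.fun_finsetProd (u := Finset.univ) fun i _ => hF (p i) i).const_smul
    (Equiv.Perm.sign p)
  refine h2.congr_deriv ?_
  rw [Finset.smul_sum]
  refine Finset.sum_congr rfl fun i _ => ?_
  rw [← Finset.mul_prod_erase Finset.univ _ (Finset.mem_univ i)]
  simp only [Matrix.updateCol_self, smul_eq_mul]
  rw [mul_comm]
  congr 2
  refine Finset.prod_congr rfl fun j hj => ?_
  rw [Matrix.updateCol_ne (Finset.ne_of_mem_erase hj)]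

end HasEntryDeriv

/-! ### The vectors `φ` and `ψ` -/

section ExpVec

variable {N : ℕ} (P Q : Matrix (Fin N) (Fin N) ℂ) (C : Fin N → ℂ)

/-- `exp(x P + t Q) C`. -/
noncomputable def expVec (x t : ℝ) : Fin N → ℂ := (NormedSpace.exp (x • P + t • Q)).mulVec C

variable {P Q}

lemma expVec_comm (x t : ℝ) : expVec P Q C x t = expVec Q P C t x := by
  rw [expVec, expVec, add_comm]

lemma hasDerivAt_expVec_fst (h : Commute P Q) (x t : ℝ) (i : Fin N) :
    HasDerivAt (fun y => expVec P Q C y t i) (P.mulVec (expVec P Q C x t) i) x := by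
  have he : ∀ y : ℝ, expVec P Q C y t =
      (NormedSpace.exp (y • P)).mulVec ((NormedSpace.exp (t • Q)).mulVec C) := fun y => by
    rw [expVec, Matrix.exp_add_of_commute _ _ ((h.smul_left y).smul_right t), Matrix.mulVec_mulVec]
  simp only [he]
  refine (hasDerivAt_mulVec (F := fun y : ℝ => NormedSpace.exp (y • P))
    (hasDerivAt_exp_real_smul P x) (v := fun _ => (NormedSpace.exp (t • Q)).mulVec C)
    (v' := 0) (fun j => hasDerivAt_const _ _) i).congr_deriv ?_
  simp [Matrix.mulVec_mulVec, Matrix.mul_assoc]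

lemma hasDerivAt_expVec_snd (h : Commute P Q) (x t : ℝ) (i : Fin N) :
    HasDerivAt (fun τ => expVec P Q C x τ i) (Q.mulVec (expVec P Q C x t) i) t := by
  simp only [expVec_comm (P := P)]
  exact hasDerivAt_expVec_fst C h.symm t x i

lemma contDiff_matrix_exp (i j : Fin N) :
    ContDiff ℝ 2 fun M : Fin N → Fin N → ℂ => NormedSpace.exp (Matrix.of M) i j := by
  have h : ∀ M : Matrix (Fin N) (Fin N) ℂ,
      let _ : NormedRing (Matrix (Fin N) (Fin N) ℂ) := Matrix.linftyOpNormedRing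
      let _ : NormedAlgebra ℝ (Matrix (Fin N) (Fin N) ℂ) := Matrix.linftyOpNormedAlgebra
      ContDiffAt ℝ 2 (NormedSpace.exp : Matrix (Fin N) (Fin N) ℂ → Matrix (Fin N) (Fin N) ℂ) M := by
    intro M
    let _ : NormedRing (Matrix (Fin N) (Fin N) ℂ) := Matrix.linftyOpNormedRing
    let _ : NormedAlgebra ℝ (Matrix (Fin N) (Fin N) ℂ) := Matrix.linftyOpNormedAlgebra
    have : CompleteSpace (Matrix (Fin N) (Fin N) ℂ) :=
      inferInstanceAs (CompleteSpace (Fin N → Fin N → ℂ))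
    exact (NormedSpace.exp_analytic (𝕂 := ℝ) M).contDiffAt
  let _ : NormedRing (Matrix (Fin N) (Fin N) ℂ) := Matrix.linftyOpNormedRing
  let _ : NormedAlgebra ℝ (Matrix (Fin N) (Fin N) ℂ) := Matrix.linftyOpNormedAlgebra
  -- The identity between the sup norm on arrays and the operator norm on matrices is continuous and
  -- linear, hence transports smoothness.
  let e : (Fin N → Fin N → ℂ) →L[ℝ] Matrix (Fin N) (Fin N) ℂ :=
    { toFun := Matrix.of, map_add' := fun _ _ => rfl, map_smul' := fun _ _ => rfl,
      cont := continuous_id }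
  let e' : Matrix (Fin N) (Fin N) ℂ →L[ℝ] ℂ :=
    { toFun := fun M => M i j, map_add' := fun _ _ => rfl, map_smul' := fun _ _ => rfl,
      cont := continuous_id.matrix_elem i j }
  have h2 : ContDiff ℝ 2 (NormedSpace.exp : Matrix (Fin N) (Fin N) ℂ → Matrix (Fin N) (Fin N) ℂ) :=
    contDiff_iff_contDiffAt.2 h
  have h3 := e'.contDiff.comp (h2.comp e.contDiff)
  exact h3

lemma contDiff_expVec (i : Fin N) : ContDiff ℝ 2 fun p : ℝ × ℝ => expVec P Q C p.1 p.2 i := by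
  have h3 : ContDiff ℝ 2 fun p : ℝ × ℝ => (fun i j => p.1 * P i j + p.2 * Q i j :
      Fin N → Fin N → ℂ) :=
    contDiff_pi.2 fun i => contDiff_pi.2 fun j =>
      ((Complex.ofRealCLM.contDiff.comp contDiff_fst).mul contDiff_const).add
        ((Complex.ofRealCLM.contDiff.comp contDiff_snd).mul contDiff_const)
  have h5 : (fun p : ℝ × ℝ => expVec P Q C p.1 p.2 i) = fun p =>
      ∑ j, NormedSpace.exp (Matrix.of fun i j => p.1 * P i j + p.2 * Q i j) i j * C j := by
    ext p
    rw [expVec, Matrix.mulVec, dotProduct]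
    congr! 5
  rw [h5]
  refine ContDiff.sum fun j _ => ContDiff.mul ?_ contDiff_const
  exact (contDiff_matrix_exp i j).comp h3

lemma hasDerivAt_mulVec_expVec_fst (M : Matrix (Fin N) (Fin N) ℂ) (h : Commute P Q) (x t : ℝ)
    (i : Fin N) : HasDerivAt (fun y => M.mulVec (expVec P Q C y t) i)
      ((M * P).mulVec (expVec P Q C x t) i) x :=
  (hasDerivAt_mulVec (F := fun _ => M) (F' := 0) (fun _ _ => hasDerivAt_const _ _)
    (hasDerivAt_expVec_fst C h x t) i).congr_deriv (by simp [Matrix.mulVec_mulVec])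

lemma hasDerivAt_mulVec_expVec_snd (M : Matrix (Fin N) (Fin N) ℂ) (h : Commute P Q) (x t : ℝ)
    (i : Fin N) : HasDerivAt (fun τ => M.mulVec (expVec P Q C x τ) i)
      ((M * Q).mulVec (expVec P Q C x t) i) t :=
  (hasDerivAt_mulVec (F := fun _ => M) (F' := 0) (fun _ _ => hasDerivAt_const _ _)
    (hasDerivAt_expVec_snd C h x t) i).congr_deriv (by simp [Matrix.mulVec_mulVec])

lemma iteratedDeriv_expVec (h : Commute P Q) (t : ℝ) (i : Fin N) (j : ℕ) :
    iteratedDeriv j (fun y => expVec P Q C y t i) = fun x => (P ^ j).mulVec (expVec P Q C x t) i := by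
  induction j with
  | zero => simp
  | succ j ih =>
    rw [iteratedDeriv_succ, ih, pow_succ]
    ext x
    exact (hasDerivAt_mulVec_expVec_fst C _ h x t i).deriv

end ExpVec

section PhiPsi

variable {n : ℕ} (A : Mat n)

/-- No invertibility is needed: the inverse of a singular matrix is 0 by convention. -/
lemma commute_inv (A : Mat n) : Commute A A⁻¹ := by
  by_cases h : IsUnit A.det
  · rw [Commute, SemiconjBy, Matrix.mul_nonsing_inv _ h, Matrix.nonsing_inv_mul _ h]
  · rw [Matrix.nonsing_inv_apply_not_isUnit _ h]
    exact Commute.zero_right A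

lemma phi_eq_expVec (C : Vec n) : phi A C = expVec (-A) (-((1 / 4 : ℂ) • A⁻¹)) C := by
  ext x t : 2
  rw [phi, expVec]
  congr 2
  ext i j
  simp
  ring

lemma psi_eq_expVec (C : Vec n) : psi A C = expVec A ((1 / 4 : ℂ) • A⁻¹) C := by
  ext x t : 2
  rw [psi, expVec]
  congr 2
  ext i j
  simp
  ring

lemma commute_psi : Commute A ((1 / 4 : ℂ) • A⁻¹) := (commute_inv A).smul_right _

lemma commute_phi : Commute (-A) (-((1 / 4 : ℂ) • A⁻¹)) := (commute_psi A).neg_left.neg_right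

/-- The matrix whose determinant is the double Wronskian of `φ` and `ψ` with `a` columns from `φ`. -/
noncomputable def wronskianMatrix (a : ℕ) (Cp Cm : Vec n) (x t : ℝ) : Mat n := Matrix.of fun i j =>
  if (j : ℕ) < a then ((-A) ^ (j : ℕ)).mulVec (phi A Cp x t) i
  else (A ^ ((j : ℕ) - a)).mulVec (psi A Cm x t) i

variable (Cp Cm : Vec n)

lemma dblWronskian_eq_det (a : ℕ) (x t : ℝ) :
    dblWronskian a (phi A Cp) (psi A Cm) x t = (wronskianMatrix A a Cp Cm x t).det := by
  rw [dblWronskian, wronskianMatrix]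
  congr 2
  ext i j
  split_ifs
  · rw [phi_eq_expVec, iteratedDeriv_expVec _ (commute_phi A)]
  · rw [psi_eq_expVec, iteratedDeriv_expVec _ (commute_psi A)]

lemma contDiff_wronskianMatrix (a : ℕ) (i j) :
    ContDiff ℝ 2 fun p : ℝ × ℝ => wronskianMatrix A a Cp Cm p.1 p.2 i j := by
  unfold wronskianMatrix
  simp only [Matrix.of_apply, Matrix.mulVec, dotProduct]
  split_ifs
  · refine ContDiff.sum fun k _ => contDiff_const.mul ?_
    rw [phi_eq_expVec]
    exact contDiff_expVec _ _
  · refine ContDiff.sum fun k _ => contDiff_const.mul ?_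
    rw [psi_eq_expVec]
    exact contDiff_expVec _ _

lemma contDiff_dblWronskian (a : ℕ) :
    ContDiff ℝ 2 fun p : ℝ × ℝ => dblWronskian a (phi A Cp) (psi A Cm) p.1 p.2 := by
  simp only [dblWronskian_eq_det, Matrix.det_apply]
  refine ContDiff.sum fun p _ => ContDiff.const_smul _ (contDiff_prod fun i _ => ?_)
  exact contDiff_wronskianMatrix A Cp Cm a _ _

/-- `Diag(-1, …, -1, 1, …, 1)`. -/
def signMatrix (n : ℕ) : Mat n := Matrix.diagonal fun j => if (j : ℕ) < n + 1 then -1 else 1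

lemma signMatrix_mul_self : signMatrix n * signMatrix n = 1 := by
  rw [signMatrix, Matrix.diagonal_mul_diagonal, ← Matrix.diagonal_one]
  congr 1
  ext j
  split_ifs <;> simp

/-- The derivative in `x` of the Wronskian matrix in terms of `A`. -/
lemma mul_wronskianMatrix_mul_sign_apply (x t : ℝ) (B : Mat n) (hB : Commute B A) (i j) :
    (B * wronskianMatrix A (n + 1) Cp Cm x t * signMatrix n) i j =
      if (j : ℕ) < n + 1 then (((-A) ^ (j : ℕ)) * -B).mulVec (phi A Cp x t) i
      else ((A ^ ((j : ℕ) - (n + 1))) * B).mulVec (psi A Cm x t) i := by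
  have h1 : ∀ k : ℕ, (-A) ^ k * -B = -(B * (-A) ^ k) := fun k => by
    rw [mul_neg, ((hB.neg_right).pow_right k).eq]
  have h2 : ∀ k : ℕ, A ^ k * B = B * A ^ k := fun k => ((hB.pow_right k).eq).symm
  rw [signMatrix, Matrix.mul_diagonal, h1, h2,
    Matrix.neg_mulVec, ← Matrix.mulVec_mulVec, ← Matrix.mulVec_mulVec]
  change B.mulVec (fun k => wronskianMatrix A (n + 1) Cp Cm x t k j) i * _ = _
  simp only [wronskianMatrix, Matrix.of_apply]
  split_ifs
  · simp
  · simp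

lemma hasEntryDeriv_wronskianMatrix_fst (x t : ℝ) :
    HasEntryDeriv (fun y => wronskianMatrix A (n + 1) Cp Cm y t)
      (A * wronskianMatrix A (n + 1) Cp Cm x t * signMatrix n) x := by
  intro i j
  rw [mul_wronskianMatrix_mul_sign_apply A Cp Cm x t A (Commute.refl A)]
  simp only [wronskianMatrix, Matrix.of_apply]
  split_ifs
  · rw [phi_eq_expVec]
    exact hasDerivAt_mulVec_expVec_fst _ _ (commute_phi A) x t i
  · rw [psi_eq_expVec]
    exact hasDerivAt_mulVec_expVec_fst _ _ (commute_psi A) x t i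

lemma hasEntryDeriv_wronskianMatrix_snd (x t : ℝ) :
    HasEntryDeriv (fun τ => wronskianMatrix A (n + 1) Cp Cm x τ)
      ((1 / 4 : ℂ) • A⁻¹ * wronskianMatrix A (n + 1) Cp Cm x t * signMatrix n) t := by
  intro i j
  rw [mul_wronskianMatrix_mul_sign_apply A Cp Cm x t _ (commute_psi A).symm]
  simp only [wronskianMatrix, Matrix.of_apply]
  split_ifs
  · rw [phi_eq_expVec]
    exact hasDerivAt_mulVec_expVec_snd _ _ (commute_phi A) x t i
  · rw [psi_eq_expVec]
    exact hasDerivAt_mulVec_expVec_snd _ _ (commute_psi A) x t i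

end PhiPsi

/-! ### The companion matrix of the Wronskian matrix -/

section Companion

variable {n : ℕ} (A : Mat n) (Cp Cm : Vec n)

/-- First column of each of the two blocks. -/
def firstIdx (n : ℕ) (p : Fin 2) : Fin ((n + 1) + (n + 1)) :=
  if p = 0 then Fin.castAdd (n + 1) 0 else Fin.natAdd (n + 1) 0

/-- Last column of each of the two blocks. -/
def lastIdx (n : ℕ) (p : Fin 2) : Fin ((n + 1) + (n + 1)) :=
  if p = 0 then Fin.castAdd (n + 1) (Fin.last n) else Fin.natAdd (n + 1) (Fin.last n)

lemma firstIdx_val (n : ℕ) (p : Fin 2) : (firstIdx n p : ℕ) = if p = 0 then 0 else n + 1 := by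
  unfold firstIdx; split_ifs <;> simp

lemma lastIdx_val (n : ℕ) (p : Fin 2) : (lastIdx n p : ℕ) = if p = 0 then n else n + 1 + n := by
  unfold lastIdx; split_ifs <;> simp

lemma lastIdx_injective (n : ℕ) : Function.Injective (lastIdx n) := by
  intro p q h
  have := congrArg Fin.val h
  rw [lastIdx_val, lastIdx_val] at this
  fin_cases p <;> fin_cases q <;> simp at this ⊢

lemma firstIdx_injective (n : ℕ) : Function.Injective (firstIdx n) := by
  intro p q h
  have := congrArg Fin.val h
  rw [firstIdx_val, firstIdx_val] at this
  fin_cases p <;> fin_cases q <;> simp at this ⊢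

/-- `Diag(-1, 1)`. -/
def sign₂ : Matrix (Fin 2) (Fin 2) ℂ := Matrix.diagonal ![-1, 1]

lemma sign₂_mul_self : sign₂ * sign₂ = 1 := by
  ext i j
  fin_cases i <;> fin_cases j <;> simp [sign₂]

/-- Rows of the identity selected by `a`. -/
def rowSel (a : Fin 2 → Fin ((n + 1) + (n + 1))) : Matrix (Fin 2) (Fin ((n + 1) + (n + 1))) ℂ :=
  (1 : Mat n).submatrix a id

/-- Columns of the identity selected by `a`. -/
def colSel (a : Fin 2 → Fin ((n + 1) + (n + 1))) : Matrix (Fin ((n + 1) + (n + 1))) (Fin 2) ℂ :=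
  (1 : Mat n).submatrix id a

lemma rowSel_mul (a : Fin 2 → Fin ((n + 1) + (n + 1))) (M : Mat n) :
    rowSel a * M = M.submatrix a id := by
  ext i j
  simp [rowSel, Matrix.mul_apply, Matrix.one_apply]

lemma rowSel_mul_colSel_of_injective {a : Fin 2 → Fin ((n + 1) + (n + 1))}
    (ha : Function.Injective a) : rowSel a * colSel a = 1 := by
  ext i j
  simp [rowSel, colSel, Matrix.mul_apply, Matrix.one_apply, ha.eq_iff]

lemma rowSel_mul_mul_colSel (a b : Fin 2 → Fin ((n + 1) + (n + 1))) (M : Mat n) :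
    rowSel a * M * colSel b = M.submatrix a b := by
  ext i j
  simp [rowSel, colSel, Matrix.mul_apply, Matrix.one_apply]

/-- The p-th selected index lies in the p-th block, on which S is the constant with which `sign₂`
multiplies row p. -/
lemma rowSel_lastIdx_mul_sign : rowSel (lastIdx n) * signMatrix n = sign₂ * rowSel (lastIdx n) := by
  ext p j
  rw [signMatrix, sign₂, Matrix.mul_diagonal, Matrix.diagonal_mul, mul_comm]
  by_cases h : lastIdx n p = j
  · subst h
    rw [lastIdx_val]
    fin_cases p <;> simp
  · simp [rowSel, h]

lemma rowSel_firstIdx_mul_sign :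
    rowSel (firstIdx n) * signMatrix n = sign₂ * rowSel (firstIdx n) := by
  ext p j
  rw [signMatrix, sign₂, Matrix.mul_diagonal, Matrix.diagonal_mul, mul_comm]
  by_cases h : firstIdx n p = j
  · subst h
    rw [firstIdx_val]
    fin_cases p <;> simp
  · simp [rowSel, h]

lemma sign_mul_colSel_lastIdx : signMatrix n * colSel (lastIdx n) = colSel (lastIdx n) * sign₂ := by
  ext j p
  rw [signMatrix, sign₂, Matrix.mul_diagonal, Matrix.diagonal_mul, mul_comm]
  by_cases h : j = lastIdx n p
  · subst h
    rw [lastIdx_val]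
    fin_cases p <;> simp
  · simp [colSel, h]

/-- `K = W⁻¹ W_x` for the Wronskian matrix `W` of `f`. -/
noncomputable def companion (x t : ℝ) : Mat n :=
  (wronskianMatrix A (n + 1) Cp Cm x t)⁻¹ * A * wronskianMatrix A (n + 1) Cp Cm x t * signMatrix n

variable {A Cp Cm}

lemma wf_eq_det (x t : ℝ) : wf A Cp Cm x t = (wronskianMatrix A (n + 1) Cp Cm x t).det :=
  dblWronskian_eq_det A Cp Cm (n + 1) x t

lemma isUnit_det_of_mem {x t : ℝ} (h : (x, t) ∈ regularSet A Cp Cm) :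
    IsUnit (wronskianMatrix A (n + 1) Cp Cm x t).det := by
  rw [← wf_eq_det]
  exact isUnit_iff_ne_zero.2 h

lemma wronskianMatrix_mul_companion {x t : ℝ} (h : (x, t) ∈ regularSet A Cp Cm) :
    wronskianMatrix A (n + 1) Cp Cm x t * companion A Cp Cm x t =
      A * wronskianMatrix A (n + 1) Cp Cm x t * signMatrix n := by
  simp only [companion, ← Matrix.mul_assoc]
  rw [Matrix.mul_nonsing_inv _ (isUnit_det_of_mem h), Matrix.one_mul]

/-- Columns of `W_x` inside a block are columns of `W`. -/
lemma companion_apply {x t : ℝ} (h : (x, t) ∈ regularSet A Cp Cm) {j : Fin ((n + 1) + (n + 1))}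
    (hj : ∀ p, lastIdx n p ≠ j) (i : Fin ((n + 1) + (n + 1))) :
    companion A Cp Cm x t i j = if (i : ℕ) = j + 1 then 1 else 0 := by
  have h0 : (j : ℕ) ≠ n := fun e => hj 0 (Fin.ext (by rw [lastIdx_val, e]; simp))
  have h1 : (j : ℕ) ≠ n + 1 + n := fun e => hj 1 (Fin.ext (by rw [lastIdx_val, e]; simp))
  have hlt := j.isLt
  -- Column j is not the last of its block, so column j + 1 lies in the same block and is its
  -- x-derivative.
  set j' : Fin ((n + 1) + (n + 1)) := ⟨j + 1, by omega⟩ with hj'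
  have hcol : ∀ k, (A * wronskianMatrix A (n + 1) Cp Cm x t * signMatrix n) k j =
      wronskianMatrix A (n + 1) Cp Cm x t k j' := by
    intro k
    rw [mul_wronskianMatrix_mul_sign_apply A Cp Cm x t A (Commute.refl A)]
    simp only [wronskianMatrix, Matrix.of_apply, hj']
    by_cases hjn : (j : ℕ) < n + 1
    · rw [if_pos hjn, if_pos (by omega), pow_succ]
    · rw [if_neg hjn, if_neg (by omega), ← pow_succ]
      congr 3
      omega
  have : companion A Cp Cm x t i j =
      ((wronskianMatrix A (n + 1) Cp Cm x t)⁻¹ * wronskianMatrix A (n + 1) Cp Cm x t) i j' := by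
    rw [companion, Matrix.mul_assoc, Matrix.mul_assoc, Matrix.mul_apply, Matrix.mul_apply]
    refine Finset.sum_congr rfl fun k _ => ?_
    rw [← Matrix.mul_assoc, hcol]
  rw [this, Matrix.nonsing_inv_mul _ (isUnit_det_of_mem h), Matrix.one_apply]
  simp [Fin.ext_iff, hj']

/-- The block of `K` in the last rows and last columns. -/
noncomputable def lastBlock (A : Mat n) (Cp Cm : Vec n) (x t : ℝ) : Matrix (Fin 2) (Fin 2) ℂ :=
  (companion A Cp Cm x t).submatrix (lastIdx n) (lastIdx n)

/-- The block of `K` in the first rows and last columns. -/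
noncomputable def firstBlock (A : Mat n) (Cp Cm : Vec n) (x t : ℝ) : Matrix (Fin 2) (Fin 2) ℂ :=
  (companion A Cp Cm x t).submatrix (firstIdx n) (lastIdx n)

/-- A shift column never has its 1 in the first row of a block: for row 0 there is no preceding
column, and for row n + 1 the preceding column is the last of the φ block. Only the last columns
contribute. -/
lemma rowSel_first_mul_companion {x t : ℝ} (h : (x, t) ∈ regularSet A Cp Cm) :
    rowSel (firstIdx n) * companion A Cp Cm x t =
      firstBlock A Cp Cm x t * rowSel (lastIdx n) := by
  ext p j
  rw [rowSel_mul, Matrix.mul_apply]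
  simp only [Matrix.submatrix_apply, id, firstBlock, rowSel, Matrix.one_apply]
  by_cases hj : ∃ q, lastIdx n q = j
  · obtain ⟨q, rfl⟩ := hj
    simp [(lastIdx_injective n).eq_iff]
  · push Not at hj
    rw [companion_apply h hj, if_neg]
    · simp [hj]
    · rw [firstIdx_val]
      have h0 : (j : ℕ) ≠ n := fun e => hj 0 (Fin.ext (by rw [lastIdx_val, e]; simp))
      split_ifs
      · exact not_false
      · omega

/-- The shift columns have zero diagonal entries. -/
lemma trace_companion {x t : ℝ} (h : (x, t) ∈ regularSet A Cp Cm) :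
    (companion A Cp Cm x t).trace = lastBlock A Cp Cm x t 0 0 + lastBlock A Cp Cm x t 1 1 := by
  rw [Matrix.trace, ← Fin.sum_univ_two fun p => lastBlock A Cp Cm x t p p]
  simp only [lastBlock, Matrix.submatrix_apply]
  rw [← Finset.sum_image (s := Finset.univ) (g := lastIdx n)
    (f := fun j => companion A Cp Cm x t j j) (fun _ _ _ _ e => lastIdx_injective n e)]
  symm
  refine Finset.sum_subset (Finset.subset_univ _) fun j _ hj => ?_
  rw [companion_apply h (fun p e => hj (Finset.mem_image.2 ⟨p, Finset.mem_univ _, e⟩)),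
    if_neg (by omega)]

/-! ### Evolution of the companion matrix -/

lemma isUnit_det_companion (hA : IsUnit A.det) {x t : ℝ} (h : (x, t) ∈ regularSet A Cp Cm) :
    IsUnit (companion A Cp Cm x t).det := by
  have hS : IsUnit (signMatrix n).det := by
    refine IsUnit.of_mul_eq_one (signMatrix n).det ?_
    rw [← Matrix.det_mul, signMatrix_mul_self, Matrix.det_one]
  have hW := isUnit_det_of_mem h
  rw [companion, Matrix.det_mul, Matrix.det_mul, Matrix.det_mul]
  exact (((Matrix.isUnit_nonsing_inv_det _ hW).mul hA).mul hW).mul hS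

/-- Multiplying `rowSel_first_mul_companion` by K⁻¹ on the right exhibits a right inverse of b as a
2×2 block of K⁻¹. -/
lemma isUnit_det_firstBlock (hA : IsUnit A.det) {x t : ℝ} (h : (x, t) ∈ regularSet A Cp Cm) :
    IsUnit (firstBlock A Cp Cm x t).det := by
  have h1 : firstBlock A Cp Cm x t *
      (rowSel (lastIdx n) * (companion A Cp Cm x t)⁻¹ * colSel (firstIdx n)) = 1 := by
    rw [← Matrix.mul_assoc, ← Matrix.mul_assoc, ← rowSel_first_mul_companion h,
      Matrix.mul_assoc (rowSel _), Matrix.mul_nonsing_inv _ (isUnit_det_companion hA h),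
      Matrix.mul_one, rowSel_mul_colSel_of_injective (firstIdx_injective n)]
  have h2 := congrArg Matrix.det h1
  rw [Matrix.det_mul, Matrix.det_one] at h2
  exact IsUnit.of_mul_eq_one _ h2

lemma rowSel_last_mul_companion_inv (hA : IsUnit A.det) {x t : ℝ} (h : (x, t) ∈ regularSet A Cp Cm) :
    rowSel (lastIdx n) * (companion A Cp Cm x t)⁻¹ =
      (firstBlock A Cp Cm x t)⁻¹ * rowSel (firstIdx n) := by
  have h1 : rowSel (firstIdx n) = firstBlock A Cp Cm x t *
      (rowSel (lastIdx n) * (companion A Cp Cm x t)⁻¹) := by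
    rw [← Matrix.mul_assoc, ← rowSel_first_mul_companion h, Matrix.mul_assoc,
      Matrix.mul_nonsing_inv _ (isUnit_det_companion hA h), Matrix.mul_one]
  rw [h1, ← Matrix.mul_assoc, Matrix.nonsing_inv_mul _ (isUnit_det_firstBlock hA h), Matrix.one_mul]

/-- Differentiating W⁻¹ A W S, the factor W⁻¹ contributes -K², and the factor W contributes W⁻¹ A² W
= (K S)². -/
lemma hasEntryDeriv_companion_fst {x t : ℝ} (h : (x, t) ∈ regularSet A Cp Cm) :
    HasEntryDeriv (fun y => companion A Cp Cm y t)
      (companion A Cp Cm x t * signMatrix n * companion A Cp Cm x t * signMatrix n -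
        companion A Cp Cm x t * companion A Cp Cm x t) x := by
  have hW := hasEntryDeriv_wronskianMatrix_fst A Cp Cm x t
  have hu := isUnit_det_of_mem h
  refine ((((hW.inv hu).mul_const A).mul hW).mul_const (signMatrix n)).congr ?_
  unfold companion
  set W := wronskianMatrix A (n + 1) Cp Cm x t
  set S := signMatrix n
  have hS : S * S = 1 := signMatrix_mul_self
  have e1 : W⁻¹ * A * W * S * S * (W⁻¹ * A * W * S) * S = W⁻¹ * A * A * W := by
    calc _ = W⁻¹ * A * W * (S * S) * (W⁻¹ * A * W) * (S * S) := by
          simp only [Matrix.mul_assoc]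
      _ = W⁻¹ * A * (W * W⁻¹) * A * W := by
          rw [hS]; simp only [Matrix.mul_assoc, Matrix.mul_one]
      _ = _ := by rw [Matrix.mul_nonsing_inv _ hu, Matrix.mul_one]
  have e2 : W⁻¹ * A * (A * W * S) * S = W⁻¹ * A * A * W := by
    calc _ = W⁻¹ * A * A * W * (S * S) := by simp only [Matrix.mul_assoc]
      _ = _ := by rw [hS, Matrix.mul_one]
  rw [e1, Matrix.add_mul, e2]
  simp only [Matrix.mul_assoc, Matrix.neg_mul]
  abel

/-- The factor W contributes the constant 1/4, since A cancels A⁻¹; the factor W⁻¹ contributes the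
other term because W⁻¹ A⁻¹ W S = S K⁻¹ S. -/
lemma hasEntryDeriv_companion_snd (hA : IsUnit A.det) {x t : ℝ} (h : (x, t) ∈ regularSet A Cp Cm) :
    HasEntryDeriv (fun τ => companion A Cp Cm x τ)
      ((1 / 4 : ℂ) • (1 - signMatrix n * (companion A Cp Cm x t)⁻¹ * signMatrix n *
        companion A Cp Cm x t)) t := by
  have hW := hasEntryDeriv_wronskianMatrix_snd A Cp Cm x t
  have hu := isUnit_det_of_mem h
  refine ((((hW.inv hu).mul_const A).mul hW).mul_const (signMatrix n)).congr ?_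
  have hS : signMatrix n * signMatrix n = 1 := signMatrix_mul_self
  have hinv : (companion A Cp Cm x t)⁻¹ = signMatrix n *
      (wronskianMatrix A (n + 1) Cp Cm x t)⁻¹ * A⁻¹ * wronskianMatrix A (n + 1) Cp Cm x t := by
    rw [companion, Matrix.mul_inv_rev, Matrix.mul_inv_rev, Matrix.mul_inv_rev,
      Matrix.nonsing_inv_nonsing_inv _ hu, Matrix.inv_eq_right_inv hS]
    simp only [Matrix.mul_assoc]
  rw [hinv]
  unfold companion
  set W := wronskianMatrix A (n + 1) Cp Cm x t
  set S := signMatrix n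
  have e1 : S * (S * W⁻¹ * A⁻¹ * W) * S * (W⁻¹ * A * W * S) =
      W⁻¹ * A⁻¹ * W * S * W⁻¹ * A * W * S := by
    calc _ = (S * S) * (W⁻¹ * A⁻¹ * W * S * W⁻¹ * A * W * S) := by simp only [Matrix.mul_assoc]
      _ = _ := by rw [hS, Matrix.one_mul]
  have e2 : W⁻¹ * A * ((1 / 4 : ℂ) • A⁻¹ * W * S) * S = (1 / 4 : ℂ) • 1 := by
    calc _ = (1 / 4 : ℂ) • (W⁻¹ * (A * A⁻¹) * W * (S * S)) := by
          simp only [Matrix.mul_assoc, Matrix.mul_smul, Matrix.smul_mul]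
      _ = _ := by
          rw [hS, Matrix.mul_one, Matrix.mul_nonsing_inv _ hA, Matrix.mul_one,
            Matrix.nonsing_inv_mul _ hu]
  rw [e1, Matrix.add_mul, e2, smul_sub]
  simp only [Matrix.mul_assoc, Matrix.neg_mul, Matrix.mul_smul, Matrix.smul_mul]
  abel

end Companion

/-! ### Evolution of the last block -/

section Blocks

variable {n : ℕ} {A : Mat n} {Cp Cm : Vec n}

/-- `s U s - U` for the last block `U`; this is minus twice the off-diagonal part of `U`. -/
noncomputable def signCommutator (A : Mat n) (Cp Cm : Vec n) (x t : ℝ) : Matrix (Fin 2) (Fin 2) ℂ :=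
  sign₂ * lastBlock A Cp Cm x t * sign₂ - lastBlock A Cp Cm x t

/-- The derivative in `t` of the last block. -/
noncomputable def lastBlockT (A : Mat n) (Cp Cm : Vec n) (x t : ℝ) : Matrix (Fin 2) (Fin 2) ℂ :=
  (1 / 4 : ℂ) • (1 - sign₂ * (firstBlock A Cp Cm x t)⁻¹ * sign₂ * firstBlock A Cp Cm x t)

/-- The last rows of K⁻¹ are b⁻¹ times the first rows of the identity, and the selectors carry S to
s; thus only b enters. -/
lemma hasEntryDeriv_lastBlock_snd (hA : IsUnit A.det) {x t : ℝ}
    (h : (x, t) ∈ regularSet A Cp Cm) :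
    HasEntryDeriv (fun τ => lastBlock A Cp Cm x τ) (lastBlockT A Cp Cm x t) t := by
  refine ((hasEntryDeriv_companion_snd hA h).submatrix (lastIdx n) (lastIdx n)).congr ?_
  rw [← rowSel_mul_mul_colSel, Matrix.mul_smul, Matrix.smul_mul, lastBlockT, Matrix.mul_sub,
    Matrix.mul_one, Matrix.sub_mul, rowSel_mul_colSel_of_injective (lastIdx_injective n)]
  congr 2
  calc _ = rowSel (lastIdx n) * signMatrix n * (companion A Cp Cm x t)⁻¹ * signMatrix n *
        companion A Cp Cm x t * colSel (lastIdx n) := by simp only [Matrix.mul_assoc]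
    _ = sign₂ * ((rowSel (lastIdx n) * (companion A Cp Cm x t)⁻¹) * signMatrix n *
        companion A Cp Cm x t * colSel (lastIdx n)) := by
      rw [rowSel_lastIdx_mul_sign]; simp only [Matrix.mul_assoc]
    _ = sign₂ * (firstBlock A Cp Cm x t)⁻¹ * (rowSel (firstIdx n) * signMatrix n) *
        companion A Cp Cm x t * colSel (lastIdx n) := by
      rw [rowSel_last_mul_companion_inv hA h]; simp only [Matrix.mul_assoc]
    _ = sign₂ * (firstBlock A Cp Cm x t)⁻¹ * sign₂ * (rowSel (firstIdx n) *
        companion A Cp Cm x t * colSel (lastIdx n)) := by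
      rw [rowSel_firstIdx_mul_sign]; simp only [Matrix.mul_assoc]
    _ = _ := by rw [rowSel_mul_mul_colSel]; rfl

/-- The first rows of K are b times the last rows of the identity, so each quadratic term of K_x
reduces to b times a term linear in U. -/
lemma hasEntryDeriv_firstBlock_fst {x t : ℝ} (h : (x, t) ∈ regularSet A Cp Cm) :
    HasEntryDeriv (fun y => firstBlock A Cp Cm y t)
      (firstBlock A Cp Cm x t * signCommutator A Cp Cm x t) x := by
  refine ((hasEntryDeriv_companion_fst h).submatrix (firstIdx n) (lastIdx n)).congr ?_
  have hU : rowSel (lastIdx n) * companion A Cp Cm x t * colSel (lastIdx n) =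
      lastBlock A Cp Cm x t := rowSel_mul_mul_colSel _ _ _
  rw [← rowSel_mul_mul_colSel, Matrix.mul_sub, Matrix.sub_mul, signCommutator, Matrix.mul_sub]
  congr 1
  · calc _ = (rowSel (firstIdx n) * companion A Cp Cm x t) * signMatrix n *
          companion A Cp Cm x t * (signMatrix n * colSel (lastIdx n)) := by
          simp only [Matrix.mul_assoc]
      _ = firstBlock A Cp Cm x t * (rowSel (lastIdx n) * signMatrix n) *
          companion A Cp Cm x t * (colSel (lastIdx n) * sign₂) := by
          rw [rowSel_first_mul_companion h, sign_mul_colSel_lastIdx]; simp only [Matrix.mul_assoc]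
      _ = firstBlock A Cp Cm x t * (sign₂ * (rowSel (lastIdx n) *
          companion A Cp Cm x t * colSel (lastIdx n)) * sign₂) := by
          rw [rowSel_lastIdx_mul_sign]; simp only [Matrix.mul_assoc]
      _ = _ := by rw [hU]
  · calc _ = (rowSel (firstIdx n) * companion A Cp Cm x t) *
          companion A Cp Cm x t * colSel (lastIdx n) := by simp only [Matrix.mul_assoc]
      _ = firstBlock A Cp Cm x t * (rowSel (lastIdx n) *
          companion A Cp Cm x t * colSel (lastIdx n)) := by
          rw [rowSel_first_mul_companion h]; simp only [Matrix.mul_assoc]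
      _ = _ := by rw [hU]

/-- Put M = s b⁻¹ s b. From b_x = b X and s X s = -X follows M_x = X M + M X; substituting M = 1 - 4
U_t eliminates b. -/
lemma hasEntryDeriv_lastBlockT_fst (hA : IsUnit A.det) {x t : ℝ}
    (h : (x, t) ∈ regularSet A Cp Cm) :
    HasEntryDeriv (fun y => lastBlockT A Cp Cm y t)
      (-(1 / 2 : ℂ) • signCommutator A Cp Cm x t +
        (signCommutator A Cp Cm x t * lastBlockT A Cp Cm x t +
          lastBlockT A Cp Cm x t * signCommutator A Cp Cm x t)) x := by
  have hu := isUnit_det_firstBlock hA h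
  have hb := hasEntryDeriv_firstBlock_fst h
  refine (((HasEntryDeriv.const (1 : Matrix (Fin 2) (Fin 2) ℂ)).sub
    ((((hb.inv hu).const_mul sign₂).mul_const sign₂).mul hb)).const_smul (1 / 4)).congr ?_
  have hs : sign₂ * sign₂ = 1 := sign₂_mul_self
  have hX : sign₂ * signCommutator A Cp Cm x t * sign₂ = -signCommutator A Cp Cm x t := by
    rw [signCommutator, Matrix.mul_sub, Matrix.sub_mul]
    have : sign₂ * (sign₂ * lastBlock A Cp Cm x t * sign₂) * sign₂ =
        (sign₂ * sign₂) * lastBlock A Cp Cm x t * (sign₂ * sign₂) := by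
      simp only [Matrix.mul_assoc]
    rw [this, hs, Matrix.one_mul, Matrix.mul_one]
    abel
  unfold lastBlockT
  set X := signCommutator A Cp Cm x t
  set b := firstBlock A Cp Cm x t
  have e1 : sign₂ * -(b⁻¹ * (b * X) * b⁻¹) * sign₂ * b = X * (sign₂ * b⁻¹ * sign₂ * b) := by
    calc _ = -(sign₂ * (b⁻¹ * b * X) * (sign₂ * sign₂) * b⁻¹ * sign₂ * b) := by
          rw [hs]; simp only [Matrix.mul_assoc, Matrix.mul_neg, Matrix.neg_mul, Matrix.one_mul]
      _ = -((sign₂ * X * sign₂) * (sign₂ * b⁻¹ * sign₂ * b)) := by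
          rw [Matrix.nonsing_inv_mul _ hu, Matrix.one_mul]; simp only [Matrix.mul_assoc]
      _ = _ := by rw [hX]; simp
  have e2 : sign₂ * b⁻¹ * sign₂ * (b * X) = (sign₂ * b⁻¹ * sign₂ * b) * X := by
    simp only [Matrix.mul_assoc]
  rw [e1, e2]
  simp only [Matrix.mul_smul, Matrix.smul_mul, Matrix.mul_sub, Matrix.sub_mul, Matrix.mul_one,
    Matrix.one_mul]
  module

lemma signCommutator_apply (x t : ℝ) :
    signCommutator A Cp Cm x t 0 0 = 0 ∧ signCommutator A Cp Cm x t 1 1 = 0 ∧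
    signCommutator A Cp Cm x t 0 1 = -2 * lastBlock A Cp Cm x t 0 1 ∧
    signCommutator A Cp Cm x t 1 0 = -2 * lastBlock A Cp Cm x t 1 0 := by
  refine ⟨?_, ?_, ?_, ?_⟩ <;> simp [signCommutator, sign₂] <;> ring

/-- The mixed derivatives of the entries of the last block. -/
lemma hasDerivAt_lastBlockT_apply (hA : IsUnit A.det) {x t : ℝ}
    (h : (x, t) ∈ regularSet A Cp Cm) :
    HasDerivAt (fun y => lastBlockT A Cp Cm y t 0 1)
      (lastBlock A Cp Cm x t 0 1 *
        (1 - 2 * (lastBlockT A Cp Cm x t 0 0 + lastBlockT A Cp Cm x t 1 1))) x ∧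
    HasDerivAt (fun y => lastBlockT A Cp Cm y t 1 0)
      (lastBlock A Cp Cm x t 1 0 *
        (1 - 2 * (lastBlockT A Cp Cm x t 0 0 + lastBlockT A Cp Cm x t 1 1))) x ∧
    HasDerivAt (fun y => lastBlockT A Cp Cm y t 0 0 + lastBlockT A Cp Cm y t 1 1)
      (-4 * (lastBlockT A Cp Cm x t 0 1 * lastBlock A Cp Cm x t 1 0 +
        lastBlock A Cp Cm x t 0 1 * lastBlockT A Cp Cm x t 1 0)) x := by
  have hd := hasEntryDeriv_lastBlockT_fst hA h
  obtain ⟨h00, h11, h01, h10⟩ := signCommutator_apply (A := A) (Cp := Cp) (Cm := Cm) x t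
  -- As X is off-diagonal, the anticommutator with U_t multiplies each off-diagonal entry of X by tr
  -- U_t, while its diagonal involves only off-diagonal entries of U_t.
  refine ⟨(hd 0 1).congr_deriv ?_, (hd 1 0).congr_deriv ?_,
    ((hd 0 0).add (hd 1 1)).congr_deriv ?_⟩ <;>
  · simp only [Matrix.add_apply, Matrix.smul_apply, Matrix.mul_apply, Fin.sum_univ_two, h00, h11,
      h01, h10, smul_eq_mul]
    ring

/-! ### The determinants `f`, `g`, `h` -/

lemma contDiff_wf : ContDiff ℝ 2 (Function.uncurry (wf A Cp Cm)) :=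
  contDiff_dblWronskian A Cp Cm (n + 1)

lemma isOpen_regularSet : IsOpen (regularSet A Cp Cm) :=
  isOpen_ne.preimage (contDiff_wf (A := A) (Cp := Cp) (Cm := Cm)).continuous

lemma eventually_mem_fst {Ω : Set (ℝ × ℝ)} (hΩ : IsOpen Ω) {x t : ℝ} (h : (x, t) ∈ Ω) :
    ∀ᶠ y in 𝓝 x, (y, t) ∈ Ω :=
  (by fun_prop : Continuous fun y : ℝ => (y, t)).tendsto x (hΩ.mem_nhds h)

lemma eventually_mem_snd {Ω : Set (ℝ × ℝ)} (hΩ : IsOpen Ω) {x t : ℝ} (h : (x, t) ∈ Ω) :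
    ∀ᶠ τ in 𝓝 t, (x, τ) ∈ Ω :=
  (by fun_prop : Continuous fun τ : ℝ => (x, τ)).tendsto t (hΩ.mem_nhds h)

lemma adjugate_mul_mul {x t : ℝ} (h : (x, t) ∈ regularSet A Cp Cm) :
    (wronskianMatrix A (n + 1) Cp Cm x t).adjugate *
      (A * wronskianMatrix A (n + 1) Cp Cm x t * signMatrix n) =
      wf A Cp Cm x t • companion A Cp Cm x t := by
  rw [← wronskianMatrix_mul_companion h, ← Matrix.mul_assoc, Matrix.adjugate_mul, wf_eq_det,
    Matrix.smul_mul, Matrix.one_mul]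

/-- Jacobi's formula: f_x / f is the trace of W⁻¹ W_x = K, that is, of U. -/
lemma dX_wf {x t : ℝ} (h : (x, t) ∈ regularSet A Cp Cm) :
    dX (wf A Cp Cm) x t =
      wf A Cp Cm x t * (lastBlock A Cp Cm x t 0 0 + lastBlock A Cp Cm x t 1 1) := by
  have hd := (hasEntryDeriv_wronskianMatrix_fst A Cp Cm x t).det
  simp only [dX, wf_eq_det] at hd ⊢
  rw [hd.deriv, adjugate_mul_mul h, Matrix.trace_smul, trace_companion h, wf_eq_det, smul_eq_mul]

/-- The auxiliary function in terms of the last block. -/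
lemma ws_eq (hA : IsUnit A.det) {x t : ℝ} (h : (x, t) ∈ regularSet A Cp Cm) :
    ws A Cp Cm x t = 1 / 2 - (lastBlockT A Cp Cm x t 0 0 + lastBlockT A Cp Cm x t 1 1) := by
  have hf : wf A Cp Cm x t ≠ 0 := h
  have hd := hasEntryDeriv_lastBlock_snd hA h
  have hft : HasDerivAt (fun τ => wf A Cp Cm x τ) (dT (wf A Cp Cm) x t) t :=
    (hasDerivAt_snd ((contDiff_wf (A := A) (Cp := Cp) (Cm := Cm)).differentiable
      (by norm_num) (x, t))).differentiableAt.hasDerivAt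
  have hXT : dXT (wf A Cp Cm) x t =
      dT (wf A Cp Cm) x t * (lastBlock A Cp Cm x t 0 0 + lastBlock A Cp Cm x t 1 1) +
      wf A Cp Cm x t * (lastBlockT A Cp Cm x t 0 0 + lastBlockT A Cp Cm x t 1 1) := by
    refine ((hft.mul ((hd 0 0).add (hd 1 1))).congr_of_eventuallyEq ?_).deriv
    filter_upwards [eventually_mem_snd isOpen_regularSet h] with τ hτ
    exact dX_wf hτ
  rw [ws, hXT, dX_wf h]
  field_simp
  ring

lemma wronskianMatrix_apply (a : ℕ) (x t : ℝ) (i j) : wronskianMatrix A a Cp Cm x t i j =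
    if (j : ℕ) < a then ((-A) ^ (j : ℕ)).mulVec (phi A Cp x t) i
    else (A ^ ((j : ℕ) - a)).mulVec (psi A Cm x t) i := rfl

/-- Replacing a column of the Wronskian matrix by a column of its derivative. -/
lemma det_updateCol_wronskianMatrix {x t : ℝ} (h : (x, t) ∈ regularSet A Cp Cm)
    (j k : Fin ((n + 1) + (n + 1))) :
    ((wronskianMatrix A (n + 1) Cp Cm x t).updateCol j fun i =>
      (A * wronskianMatrix A (n + 1) Cp Cm x t * signMatrix n) i k).det =
      wf A Cp Cm x t * companion A Cp Cm x t j k := by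
  rw [← Matrix.cramer_apply, Matrix.cramer_eq_adjugate_mulVec]
  exact congrFun (congrFun (adjugate_mul_mul h) j) k

lemma derivative_col_last_fst (x t : ℝ) (i) :
    (A * wronskianMatrix A (n + 1) Cp Cm x t * signMatrix n) i (lastIdx n 0) =
      ((-A) ^ (n + 1)).mulVec (phi A Cp x t) i := by
  rw [mul_wronskianMatrix_mul_sign_apply A Cp Cm x t A (Commute.refl A), lastIdx_val]
  simp [pow_succ]

lemma derivative_col_last_snd (x t : ℝ) (i) :
    (A * wronskianMatrix A (n + 1) Cp Cm x t * signMatrix n) i (lastIdx n 1) =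
      (A ^ (n + 1)).mulVec (psi A Cm x t) i := by
  rw [mul_wronskianMatrix_mul_sign_apply A Cp Cm x t A (Commute.refl A), lastIdx_val]
  simp [pow_succ]

/-- Replacing the last φ column of W by the next derivative of ψ gives, by Cramer's rule, f times an
entry of U. Moving that column to the end is a cycle of n + 2 columns, of sign (-1)^(n+1). -/
lemma wh_eq {x t : ℝ} (h : (x, t) ∈ regularSet A Cp Cm) :
    wh A Cp Cm x t = 2 * (-1) ^ (n + 1) * lastBlock A Cp Cm x t 0 1 * wf A Cp Cm x t := by
  have hle : lastIdx n 0 ≤ lastIdx n 1 := by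
    rw [Fin.le_def, lastIdx_val, lastIdx_val]; simp
  have hM : wronskianMatrix A n Cp Cm x t =
      ((wronskianMatrix A (n + 1) Cp Cm x t).updateCol (lastIdx n 0) fun i =>
        (A * wronskianMatrix A (n + 1) Cp Cm x t * signMatrix n) i (lastIdx n 1)).submatrix id
          (Fin.cycleIcc (lastIdx n 0) (lastIdx n 1)) := by
    ext i j
    rw [Matrix.submatrix_apply, id]
    have hj := j.isLt
    rcases lt_trichotomy (j : ℕ) (n + 1 + n) with hlt | heq | hgt
    · by_cases hjn : (j : ℕ) < n
      · rw [Fin.cycleIcc_of_lt (by rw [Fin.lt_def, lastIdx_val]; simpa using hjn),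
          Matrix.updateCol_ne (by rintro rfl; simp [lastIdx_val] at hjn), wronskianMatrix_apply,
          wronskianMatrix_apply, if_pos hjn, if_pos (by omega)]
      -- Addition in `Fin` wraps around, but not before the last column.
      · have hv : ((j + 1 : Fin ((n + 1) + (n + 1))) : ℕ) = j + 1 :=
          Fin.val_add_one_of_lt' (by omega)
        rw [Fin.cycleIcc_of_ge_of_lt (by rw [Fin.le_def, lastIdx_val]; simpa using hjn)
          (by rw [Fin.lt_def, lastIdx_val]; simpa using hlt),
          Matrix.updateCol_ne (by
            intro e
            have := congrArg Fin.val e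
            rw [hv, lastIdx_val] at this
            simp at this; omega), wronskianMatrix_apply,
          wronskianMatrix_apply, if_neg hjn, hv, if_neg (by omega)]
        rw [show (j : ℕ) + 1 - (n + 1) = j - n by omega]
    · have e : j = lastIdx n 1 := Fin.ext (by rw [heq, lastIdx_val]; simp)
      rw [e, Fin.cycleIcc_of_last hle, Matrix.updateCol_self, derivative_col_last_snd,
        wronskianMatrix_apply, lastIdx_val, if_neg (by simp)]
      congr 3
      simp
    · omega
  rw [wh, dblWronskian_eq_det, hM, Matrix.det_permute', Fin.sign_cycleIcc_of_le hle,
    det_updateCol_wronskianMatrix h, lastIdx_val, lastIdx_val]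
  have : (if (1 : Fin 2) = 0 then n else n + 1 + n) - (if (0 : Fin 2) = 0 then n else n + 1 + n) =
      n + 1 := by simp
  rw [this, lastBlock]
  push_cast
  simp only [Matrix.submatrix_apply]
  ring

/-- As for h, now with the last ψ column replaced by the next derivative of φ; a cycle of the n + 1
columns of the ψ block brings it to its place, with sign (-1)^n. -/
lemma wg_eq {x t : ℝ} (h : (x, t) ∈ regularSet A Cp Cm) :
    wg A Cp Cm x t = 2 * (-1) ^ n * lastBlock A Cp Cm x t 1 0 * wf A Cp Cm x t := by
  have hle : firstIdx n 1 ≤ lastIdx n 1 := by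
    rw [Fin.le_def, firstIdx_val, lastIdx_val]; simp
  have hM : (wronskianMatrix A (n + 2) Cp Cm x t).submatrix id
        (Fin.cycleIcc (firstIdx n 1) (lastIdx n 1)) =
      (wronskianMatrix A (n + 1) Cp Cm x t).updateCol (lastIdx n 1) fun i =>
        (A * wronskianMatrix A (n + 1) Cp Cm x t * signMatrix n) i (lastIdx n 0) := by
    ext i j
    rw [Matrix.submatrix_apply, id]
    have hj := j.isLt
    rcases lt_trichotomy (j : ℕ) (n + 1 + n) with hlt | heq | hgt
    · have hne : j ≠ lastIdx n 1 := by
        rintro rfl; simp [lastIdx_val] at hlt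
      by_cases hjn : (j : ℕ) < n + 1
      · rw [Fin.cycleIcc_of_lt (by rw [Fin.lt_def, firstIdx_val]; simpa using hjn),
          Matrix.updateCol_ne hne, wronskianMatrix_apply,
          wronskianMatrix_apply, if_pos hjn, if_pos (by omega)]
      · have hv : ((j + 1 : Fin ((n + 1) + (n + 1))) : ℕ) = j + 1 :=
          Fin.val_add_one_of_lt' (by omega)
        rw [Fin.cycleIcc_of_ge_of_lt (by rw [Fin.le_def, firstIdx_val]; simpa using hjn)
          (by rw [Fin.lt_def, lastIdx_val]; simpa using hlt),
          Matrix.updateCol_ne hne, wronskianMatrix_apply,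
          wronskianMatrix_apply, if_neg hjn, hv, if_neg (by omega)]
        rw [show (j : ℕ) + 1 - (n + 2) = j - (n + 1) by omega]
    · have e : j = lastIdx n 1 := Fin.ext (by rw [heq, lastIdx_val]; simp)
      rw [e, Fin.cycleIcc_of_last hle, Matrix.updateCol_self, derivative_col_last_fst,
        wronskianMatrix_apply, firstIdx_val, if_pos (by simp)]
      simp
    · omega
  have hdet := congrArg Matrix.det hM
  rw [Matrix.det_permute', Fin.sign_cycleIcc_of_le hle, det_updateCol_wronskianMatrix h,
    lastIdx_val, firstIdx_val] at hdet
  have he : (if (1 : Fin 2) = 0 then n else n + 1 + n) - (if (1 : Fin 2) = 0 then 0 else n + 1) =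
      n := by simp
  rw [he] at hdet
  push_cast at hdet
  have hsq : ((-1 : ℂ) ^ n) * (-1) ^ n = 1 := by rw [← mul_pow]; simp
  rw [wg, dblWronskian_eq_det, lastBlock]
  simp only [Matrix.submatrix_apply]
  linear_combination (-2 * (wronskianMatrix A (n + 2) Cp Cm x t).det) * hsq + 2 * (-1) ^ n * hdet

lemma wq_eq {x t : ℝ} (h : (x, t) ∈ regularSet A Cp Cm) :
    wq A Cp Cm x t = 2 * (-1) ^ (n + 1) * lastBlock A Cp Cm x t 0 1 := by
  have hf : wf A Cp Cm x t ≠ 0 := h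
  rw [wq, wh_eq h, mul_div_cancel_right₀ _ hf]

lemma wr_eq {x t : ℝ} (h : (x, t) ∈ regularSet A Cp Cm) :
    wr A Cp Cm x t = 2 * (-1) ^ (n + 1) * lastBlock A Cp Cm x t 1 0 := by
  have hf : wf A Cp Cm x t ≠ 0 := h
  rw [wr, wg_eq h, mul_div_cancel_right₀ _ hf]
  ring

lemma contDiffOn_wq : ContDiffOn ℝ 2 (Function.uncurry (wq A Cp Cm)) (regularSet A Cp Cm) := by
  have h1 : ContDiff ℝ 2 (Function.uncurry (wh A Cp Cm)) :=
    contDiff_const.mul (contDiff_dblWronskian A Cp Cm n)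
  have h2 : ContDiffOn ℝ 2 (fun p => (Function.uncurry (wf A Cp Cm) p)⁻¹) (regularSet A Cp Cm) :=
    contDiff_wf.contDiffOn.inv fun p hp => hp
  exact (h1.contDiffOn.mul h2).congr fun p _ => div_eq_mul_inv _ _

lemma contDiffOn_wr : ContDiffOn ℝ 2 (Function.uncurry (wr A Cp Cm)) (regularSet A Cp Cm) := by
  have h1 : ContDiff ℝ 2 (Function.uncurry (wg A Cp Cm)) :=
    contDiff_const.mul (contDiff_dblWronskian A Cp Cm (n + 2))
  have h2 : ContDiffOn ℝ 2 (fun p => (Function.uncurry (wf A Cp Cm) p)⁻¹) (regularSet A Cp Cm) :=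
    contDiff_wf.contDiffOn.inv fun p hp => hp
  exact (h1.contDiffOn.mul h2).neg.congr fun p _ => congrArg Neg.neg (div_eq_mul_inv _ _)

/-- The `x`-derivative of `q_t` computed from formulas valid on an open set. -/
lemma dXT_eq_of_eqOn {Ω : Set (ℝ × ℝ)} (hΩ : IsOpen Ω) {u v w : ℝ → ℝ → ℂ} {c : ℂ}
    (hu : ContDiffOn ℝ 2 (Function.uncurry u) Ω)
    (huv : ∀ x t, (x, t) ∈ Ω → u x t = c * v x t)
    (hv : ∀ x t, (x, t) ∈ Ω → HasDerivAt (fun τ => v x τ) (w x t) t) {x t : ℝ} {d : ℂ}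
    (h : (x, t) ∈ Ω) (hw : HasDerivAt (fun y => w y t) d x) : dXT u x t = c * d := by
  -- The available formulas give first the t-derivative and then its x-derivative, so the order of
  -- differentiation is exchanged.
  rw [dXT_eq_dX_dT (hu.contDiffAt (hΩ.mem_nhds h))]
  refine ((hw.const_mul c).congr_of_eventuallyEq ?_).deriv
  filter_upwards [eventually_mem_fst hΩ h] with y hy
  refine (((hv y t hy).const_mul c).congr_of_eventuallyEq ?_).deriv
  filter_upwards [eventually_mem_snd hΩ hy] with τ hτ
  exact huv y τ hτ

/-- The double Wronskian solutions of the AKNS(-1) system. -/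
theorem isSolution_wronskian (hA : IsUnit A.det) :
    IsSolution (regularSet A Cp Cm) (wq A Cp Cm) (wr A Cp Cm) (ws A Cp Cm) := by
  have hΩ : IsOpen (regularSet A Cp Cm) := isOpen_regularSet
  have hs : ∀ x t, (x, t) ∈ regularSet A Cp Cm → HasDerivAt (fun y => ws A Cp Cm y t)
      (4 * (lastBlockT A Cp Cm x t 0 1 * lastBlock A Cp Cm x t 1 0 +
        lastBlock A Cp Cm x t 0 1 * lastBlockT A Cp Cm x t 1 0)) x := by
    intro x t h
    refine (((hasDerivAt_lastBlockT_apply hA h).2.2.const_sub (1 / 2)).congr_of_eventuallyEq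
      ?_).congr_deriv (by ring)
    filter_upwards [eventually_mem_fst hΩ h] with y hy
    exact ws_eq hA hy
  refine ⟨contDiffOn_wq, contDiffOn_wr, fun x t h => (hs x t h).differentiableAt,
    fun x t h => ?_, fun x t h => ?_, fun x t h => ?_⟩
  · rw [dXT_eq_of_eqOn hΩ contDiffOn_wq (fun x t h => wq_eq h)
      (fun x t h => hasEntryDeriv_lastBlock_snd hA h 0 1) h
      (hasDerivAt_lastBlockT_apply hA h).1, wq_eq h, ws_eq hA h]
    ring
  · rw [dXT_eq_of_eqOn hΩ contDiffOn_wr (fun x t h => wr_eq h)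
      (fun x t h => hasEntryDeriv_lastBlock_snd hA h 1 0) h
      (hasDerivAt_lastBlockT_apply hA h).2.1, wr_eq h, ws_eq hA h]
    ring
  · have hd := hasEntryDeriv_lastBlock_snd hA h
    have hp : HasDerivAt (fun τ => prod (wq A Cp Cm) (wr A Cp Cm) x τ)
        (4 * (lastBlockT A Cp Cm x t 0 1 * lastBlock A Cp Cm x t 1 0 +
        lastBlock A Cp Cm x t 0 1 * lastBlockT A Cp Cm x t 1 0)) t := by
      refine (((hd 0 1).mul (hd 1 0)).const_mul 4).congr_of_eventuallyEq ?_
      filter_upwards [eventually_mem_snd hΩ h] with τ hτ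
      -- The signs in q and r coincide, so q r is four times the product of the off-diagonal entries
      -- of U.
      have hsq : ((-1 : ℂ) ^ (n + 1)) * (-1) ^ (n + 1) = 1 := by rw [← mul_pow]; simp
      simp only [prod, wq_eq hτ, wr_eq hτ, Pi.mul_apply]
      linear_combination (4 * lastBlock A Cp Cm x τ 0 1 * lastBlock A Cp Cm x τ 1 0) * hsq
    exact (hs x t h).deriv.trans hp.deriv.symm

end Blocks

/-! ### The symmetry of the constrained double Wronskians -/

section Symmetry

lemma exp_map_conj {N : ℕ} (M : Matrix (Fin N) (Fin N) ℂ) :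
    (NormedSpace.exp M).map conj = NormedSpace.exp (M.map conj) := by
  have h : ∀ M : Matrix (Fin N) (Fin N) ℂ, M.map conj = (M.conjTranspose).transpose := fun M => rfl
  rw [h, h, Matrix.exp_transpose, Matrix.exp_conjTranspose]

lemma map_conj_mul {ι κ μ : Type*} [Fintype κ] (M : Matrix ι κ ℂ) (M' : Matrix κ μ ℂ) :
    (M * M').map conj = M.map conj * M'.map conj := Matrix.map_mul

lemma map_conj_pow {ι : Type*} [Fintype ι] [DecidableEq ι] (M : Matrix ι ι ℂ) (k : ℕ) :
    (M ^ k).map conj = M.map conj ^ k :=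
  map_pow (RingHom.mapMatrix (starRingEnd ℂ)) M k

lemma det_map_conj {ι : Type*} [Fintype ι] [DecidableEq ι] (M : Matrix ι ι ℂ) :
    (M.map conj).det = conj M.det := (RingHom.map_det _ _).symm

variable {n : ℕ} {σ : ℝ} {A T : Mat n} {Cp Cm : Vec n}

lemma conjVec_mulVec (M : Mat n) (v : Vec n) :
    conjVec (M.mulVec v) = (M.map conj).mulVec (conjVec v) := by
  ext i
  simp [conjVec, Matrix.mulVec, dotProduct]

lemma conjVec_conjVec (v : Vec n) : conjVec (conjVec v) = v := by
  ext i
  simp [conjVec]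

lemma Constraint.mul_eq (hT : Constraint σ A T) : A * T = -((σ : ℂ) • (T * A.map conj)) :=
  eq_neg_of_add_eq_zero_left hT.1

/-- Since σ² = 1, the inverse of T is -σ T*. -/
lemma Constraint.isUnit_det (hσ : σ = 1 ∨ σ = -1) (hT : Constraint σ A T) : IsUnit T.det := by
  have h : T * (-(σ : ℂ) • T.map conj) = 1 := by
    rw [Matrix.mul_smul, hT.2, smul_smul]
    have : -(σ : ℂ) * -(σ : ℂ) = 1 := by linear_combination sq_eq_one_of_sign hσ
    rw [this, one_smul]
  have h2 := congrArg Matrix.det h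
  rw [Matrix.det_mul, Matrix.det_one] at h2
  exact IsUnit.of_mul_eq_one _ h2

lemma Constraint.inv_mul_eq (hσ : σ = 1 ∨ σ = -1) (hA : IsUnit A.det) (hT : Constraint σ A T) :
    A⁻¹ * T = -((σ : ℂ) • (T * (A⁻¹).map conj)) := by
  have h1 : A.map conj * (A⁻¹).map conj = 1 := by
    rw [← map_conj_mul, Matrix.mul_nonsing_inv _ hA, map_conj_one]
  have h2 : A * (-((σ : ℂ) • (T * (A⁻¹).map conj))) = T := by
    rw [Matrix.mul_neg, Matrix.mul_smul, ← Matrix.mul_assoc, hT.mul_eq, Matrix.neg_mul,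
      Matrix.smul_mul, Matrix.mul_assoc, h1, Matrix.mul_one, smul_neg, neg_neg, smul_smul, ← sq,
      sq_eq_one_of_sign hσ, one_smul]
  rw [← Matrix.one_mul (-((σ : ℂ) • (T * (A⁻¹).map conj))), ← Matrix.nonsing_inv_mul _ hA,
    Matrix.mul_assoc, h2]

/-- T intertwines the exponent of ψ at (x,t) with the conjugated exponent of φ at (σx,σt), hence
also their exponentials. -/
lemma psi_eq_mulVec_conj_phi (hσ : σ = 1 ∨ σ = -1) (hA : IsUnit A.det) (hT : Constraint σ A T)
    (hC : Cm = T.mulVec (conjVec Cp)) (x t : ℝ) :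
    psi A Cm x t = T.mulVec (conjVec (phi A Cp (σ * x) (σ * t))) := by
  have hu := hT.isUnit_det hσ
  set P : Mat n := -(((σ * x : ℝ) : ℂ) • A) - (((σ * t : ℝ) : ℂ) / 4) • A⁻¹ with hP
  have hPc : P.map conj =
      -(((σ * x : ℝ) : ℂ) • A.map conj) - (((σ * t : ℝ) : ℂ) / 4) • (A⁻¹).map conj := by
    ext i j
    simp only [hP, Matrix.map_apply, Matrix.sub_apply, Matrix.neg_apply, Matrix.smul_apply,
      smul_eq_mul, map_sub, map_neg, map_mul, map_div₀, Complex.conj_ofReal, map_ofNat]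
  have hQ : ((x : ℂ) • A + ((t : ℂ) / 4) • A⁻¹) * T = T * P.map conj := by
    rw [hPc, Matrix.add_mul, Matrix.smul_mul, Matrix.smul_mul, hT.mul_eq, hT.inv_mul_eq hσ hA,
      Matrix.mul_sub, Matrix.mul_neg, Matrix.mul_smul, Matrix.mul_smul]
    push_cast
    module
  have hQ' : (x : ℂ) • A + ((t : ℂ) / 4) • A⁻¹ = T * P.map conj * T⁻¹ := by
    rw [← hQ, Matrix.mul_assoc, Matrix.mul_nonsing_inv _ hu, Matrix.mul_one]
  rw [psi, phi, ← hP, conjVec_mulVec, exp_map_conj, hQ',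
    Matrix.exp_conj _ _ ((Matrix.isUnit_iff_isUnit_det _).2 hu), hC, Matrix.mulVec_mulVec,
    Matrix.mulVec_mulVec, Matrix.mul_assoc, Matrix.mul_assoc, Matrix.nonsing_inv_mul _ hu,
    Matrix.mul_one]

/-- The relation for ψ is inverted by reflecting and conjugating it and using T T* = -σ I. -/
lemma phi_eq_mulVec_conj_psi (hσ : σ = 1 ∨ σ = -1) (hA : IsUnit A.det) (hT : Constraint σ A T)
    (hC : Cm = T.mulVec (conjVec Cp)) (x t : ℝ) :
    phi A Cp x t = -((σ : ℂ) • T.mulVec (conjVec (psi A Cm (σ * x) (σ * t)))) := by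
  rw [psi_eq_mulVec_conj_phi hσ hA hT hC, mul_self_of_sign hσ, mul_self_of_sign hσ, conjVec_mulVec,
    conjVec_conjVec, Matrix.mulVec_mulVec, hT.2, Matrix.smul_mulVec, Matrix.one_mulVec, smul_smul,
    ← neg_smul]
  have : -((σ : ℂ) * -(σ : ℂ)) = 1 := by linear_combination sq_eq_one_of_sign hσ
  rw [this, one_smul]

lemma Constraint.pow_mul_eq (hT : Constraint σ A T) (k : ℕ) :
    A ^ k * T = (-(σ : ℂ)) ^ k • (T * A.map conj ^ k) := by
  induction k with
  | zero => simp
  | succ k ih =>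
    rw [pow_succ', Matrix.mul_assoc, ih, Matrix.mul_smul, ← Matrix.mul_assoc, hT.mul_eq,
      Matrix.neg_mul, Matrix.smul_mul, Matrix.mul_assoc, ← pow_succ']
    module

/-- The signed permutation matrix exchanging the two blocks of columns. -/
def blockSwap (n : ℕ) (σ : ℝ) : Mat n := Matrix.of fun i j =>
  if (j : ℕ) < n + 1 then (if (i : ℕ) = j + (n + 1) then -(σ : ℂ) ^ ((j : ℕ) + 1) else 0)
  else (if (j : ℕ) = i + (n + 1) then (σ : ℂ) ^ (i : ℕ) else 0)

lemma mul_blockSwap_apply_of_lt (M : Mat n) (i : Fin ((n + 1) + (n + 1)))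
    {j j' : Fin ((n + 1) + (n + 1))} (hj : (j' : ℕ) = j + (n + 1)) :
    (M * blockSwap n σ) i j = M i j' * -(σ : ℂ) ^ ((j : ℕ) + 1) := by
  have hlt := j'.isLt
  rw [Matrix.mul_apply, Finset.sum_eq_single j']
  · simp only [blockSwap, Matrix.of_apply]
    rw [if_pos (by omega), if_pos hj]
  · intro k _ hk
    simp only [blockSwap, Matrix.of_apply]
    rw [if_pos (by omega), if_neg (fun e => hk (Fin.ext (by omega))), mul_zero]
  · simp

lemma mul_blockSwap_apply_of_ge (M : Mat n) (i : Fin ((n + 1) + (n + 1)))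
    {j j' : Fin ((n + 1) + (n + 1))} (hj : (j : ℕ) = j' + (n + 1)) :
    (M * blockSwap n σ) i j = M i j' * (σ : ℂ) ^ (j' : ℕ) := by
  rw [Matrix.mul_apply, Finset.sum_eq_single j']
  · simp only [blockSwap, Matrix.of_apply]
    rw [if_neg (by omega), if_pos hj]
  · intro k _ hk
    simp only [blockSwap, Matrix.of_apply]
    rw [if_neg (by omega), if_neg (fun e => hk (Fin.ext (by omega))), mul_zero]
  · simp

/-- Exchanging the two blocks interchanges the eigenvalues -1 and 1 of S. -/
lemma sign_mul_blockSwap : blockSwap n σ * signMatrix n = -(signMatrix n * blockSwap n σ) := by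
  ext i j
  have hi := i.isLt
  have hj := j.isLt
  rw [Matrix.neg_apply, signMatrix, Matrix.mul_diagonal, Matrix.diagonal_mul]
  simp only [blockSwap, Matrix.of_apply]
  split_ifs <;> first | omega | simp

lemma signMatrix_map_conj : (signMatrix n).map conj = signMatrix n := by
  rw [signMatrix, Matrix.diagonal_map (map_zero _)]
  congr 1
  ext j
  split_ifs <;> simp

/-- Column by column: moving powers of A past T produces (-σ)^k, whose sign is matched by (-A)^k in
the φ block. The further factor -σ in the φ columns comes from T T* = -σ I. -/
lemma wronskianMatrix_symm (hσ : σ = 1 ∨ σ = -1) (hA : IsUnit A.det) (hT : Constraint σ A T)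
    (hC : Cm = T.mulVec (conjVec Cp)) (x t : ℝ) :
    wronskianMatrix A (n + 1) Cp Cm x t =
      T * (wronskianMatrix A (n + 1) Cp Cm (σ * x) (σ * t)).map conj * blockSwap n σ := by
  have hcol : ∀ (M : Mat n) (v : Vec n), T.mulVec (fun l => conj (M.mulVec v l)) =
      (T * M.map conj).mulVec (conjVec v) := fun M v => by
    have : (fun l => conj (M.mulVec v l)) = conjVec (M.mulVec v) := rfl
    rw [this, conjVec_mulVec, Matrix.mulVec_mulVec]
  have hn : ∀ k : ℕ, (-A) ^ k = (-1 : ℂ) ^ k • A ^ k := fun k => by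
    rw [← smul_pow, neg_one_smul]
  have hn' : ∀ k : ℕ, ((-1 : ℂ) ^ k • A ^ k).map conj = (-1 : ℂ) ^ k • (A ^ k).map conj :=
    fun k => by ext i j; simp
  have hm1 : ∀ k : ℕ, (-1 : ℂ) ^ k * (-1) ^ k = 1 := fun k => by rw [← mul_pow]; simp
  ext i j
  have hlt := j.isLt
  by_cases hj : (j : ℕ) < n + 1
  · have hj' : (j : ℕ) + (n + 1) < (n + 1) + (n + 1) := by omega
    rw [mul_blockSwap_apply_of_lt (j' := ⟨j + (n + 1), hj'⟩) _ _ rfl]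
    change _ = T.mulVec (fun l =>
      conj (wronskianMatrix A (n + 1) Cp Cm (σ * x) (σ * t) l ⟨j + (n + 1), hj'⟩)) i * _
    simp only [wronskianMatrix_apply, hj, if_true, show ¬(j : ℕ) + (n + 1) < n + 1 by omega,
      if_false, Nat.add_sub_cancel]
    rw [hcol, map_conj_pow, phi_eq_mulVec_conj_psi hσ hA hT hC, Matrix.mulVec_neg, Matrix.mulVec_smul,
      Matrix.mulVec_mulVec, hn, Matrix.smul_mul, hT.pow_mul_eq, smul_smul, Matrix.smul_mulVec]
    simp only [Pi.neg_apply, Pi.smul_apply, smul_eq_mul]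
    rw [neg_pow (σ : ℂ) j, pow_succ]
    linear_combination (-(σ : ℂ) ^ (j : ℕ) * σ *
      ((T * A.map conj ^ (j : ℕ)).mulVec (conjVec (psi A Cm (σ * x) (σ * t)))) i) * hm1 j
  · have hj' : (j : ℕ) - (n + 1) < (n + 1) + (n + 1) := by omega
    rw [mul_blockSwap_apply_of_ge (j' := ⟨j - (n + 1), hj'⟩) _ _
      (show (j : ℕ) = j - (n + 1) + (n + 1) by omega)]
    change _ = T.mulVec (fun l =>
      conj (wronskianMatrix A (n + 1) Cp Cm (σ * x) (σ * t) l ⟨j - (n + 1), hj'⟩)) i * _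
    simp only [wronskianMatrix_apply, hj, if_false, show (j : ℕ) - (n + 1) < n + 1 by omega, if_true]
    rw [hcol, hn, hn', map_conj_pow, psi_eq_mulVec_conj_phi hσ hA hT hC,
      Matrix.mulVec_mulVec, hT.pow_mul_eq, Matrix.mul_smul, Matrix.smul_mulVec, Matrix.smul_mulVec]
    simp only [Pi.smul_apply, smul_eq_mul]
    rw [neg_pow (σ : ℂ)]
    ring

/-- The factor in the symmetry of `f`. -/
lemma exists_wf_symm (hσ : σ = 1 ∨ σ = -1) (hA : IsUnit A.det) (hT : Constraint σ A T)
    (hC : Cm = T.mulVec (conjVec Cp)) :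
    ∃ κ : ℂ, wf A Cp Cm = fun x t => κ * conj (wf A Cp Cm (σ * x) (σ * t)) := by
  refine ⟨T.det * (blockSwap n σ).det, ?_⟩
  ext x t
  rw [wf_eq_det, wronskianMatrix_symm hσ hA hT hC, Matrix.det_mul, Matrix.det_mul, det_map_conj,
    wf_eq_det]
  ring

lemma mem_regularSet_symm (hσ : σ = 1 ∨ σ = -1) (hA : IsUnit A.det) (hT : Constraint σ A T)
    (hC : Cm = T.mulVec (conjVec Cp)) {x t : ℝ} (h : (x, t) ∈ regularSet A Cp Cm) :
    (σ * x, σ * t) ∈ regularSet A Cp Cm := by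
  obtain ⟨κ, hκ⟩ := exists_wf_symm hσ hA hT hC
  have h1 : wf A Cp Cm x t ≠ 0 := h
  rw [hκ] at h1
  intro h2
  exact h1 (by simp [show wf A Cp Cm (σ * x) (σ * t) = 0 from h2])

/-- The constant factor κ in the symmetry of f drops out of (ln f)_xt, and the two derivatives
contribute σ² = 1. -/
lemma ws_symm (hσ : σ = 1 ∨ σ = -1) (hA : IsUnit A.det) (hT : Constraint σ A T)
    (hC : Cm = T.mulVec (conjVec Cp)) {x t : ℝ} (h : (x, t) ∈ regularSet A Cp Cm) :
    ws A Cp Cm (σ * x) (σ * t) = conj (ws A Cp Cm x t) := by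
  obtain ⟨κ, hκ⟩ := exists_wf_symm hσ hA hT hC
  set F := wf A Cp Cm with hF
  have h0 : F (σ * x) (σ * t) = κ * conj (F x t) := by
    conv_lhs => rw [hκ]
    simp only [mul_self_of_sign hσ]
  have hX : dX F (σ * x) (σ * t) = κ * (σ * conj (dX F x t)) := by
    conv_lhs => rw [hκ, dX_const_mul, dX_conj_comp]
    simp only [mul_self_of_sign hσ]
  have hT' : dT F (σ * x) (σ * t) = κ * (σ * conj (dT F x t)) := by
    conv_lhs => rw [hκ, dT_const_mul, dT_conj_comp]
    simp only [mul_self_of_sign hσ]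
  have hXT : dXT F (σ * x) (σ * t) = κ * (σ ^ 2 * conj (dXT F x t)) := by
    conv_lhs => rw [hκ, dXT_const_mul, dXT_conj_comp]
    simp only [mul_self_of_sign hσ]
  have hf : F x t ≠ 0 := h
  have hκ0 : κ ≠ 0 := by
    rintro rfl
    rw [hκ] at hf
    simp at hf
  have hfc : conj (F x t) ≠ 0 := by simpa using hf
  have hs2 := sq_eq_one_of_sign hσ
  simp only [ws, ← hF, h0, hX, hT', hXT, map_sub, map_div₀, map_mul, map_pow, map_one, map_ofNat]
  rw [hs2]
  congr 1
  rw [div_eq_div_iff (pow_ne_zero 2 (mul_ne_zero hκ0 hfc)) (pow_ne_zero 2 hfc)]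
  linear_combination (-(κ ^ 2) * conj (dX F x t) * conj (dT F x t) * conj (F x t) ^ 2) * hs2

/-- Insert the symmetry of W into W K = A W S. The minus sign of A T = -σ T A* cancels that of J S =
-S J, where J is `blockSwap`, and the invertible factor T W* is removed. -/
lemma blockSwap_mul_companion (hσ : σ = 1 ∨ σ = -1) (hA : IsUnit A.det) (hT : Constraint σ A T)
    (hC : Cm = T.mulVec (conjVec Cp)) {x t : ℝ} (h : (x, t) ∈ regularSet A Cp Cm) :
    blockSwap n σ * companion A Cp Cm x t =
      (σ : ℂ) • ((companion A Cp Cm (σ * x) (σ * t)).map conj * blockSwap n σ) := by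
  have h' := mem_regularSet_symm hσ hA hT hC h
  have e1 := wronskianMatrix_mul_companion h
  have e2 := congrArg (fun M : Mat n => M.map conj) (wronskianMatrix_mul_companion h')
  simp only [map_conj_mul, signMatrix_map_conj] at e2
  rw [wronskianMatrix_symm hσ hA hT hC] at e1
  set V := (wronskianMatrix A (n + 1) Cp Cm (σ * x) (σ * t)).map conj with hV
  set K' := (companion A Cp Cm (σ * x) (σ * t)).map conj
  have hu : IsUnit (T * V).det := by
    rw [Matrix.det_mul]
    exact (hT.isUnit_det hσ).mul (isUnit_det_map_conj (isUnit_det_of_mem h'))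
  have key : (T * V) * (blockSwap n σ * companion A Cp Cm x t) =
      (T * V) * ((σ : ℂ) • (K' * blockSwap n σ)) := by
    calc _ = T * V * blockSwap n σ * companion A Cp Cm x t := by rw [Matrix.mul_assoc (T * V)]
      _ = A * T * V * (blockSwap n σ * signMatrix n) := by rw [e1]; simp only [Matrix.mul_assoc]
      _ = (σ : ℂ) • (T * (A.map conj * V * signMatrix n) * blockSwap n σ) := by
        rw [hT.mul_eq, sign_mul_blockSwap]
        simp only [Matrix.neg_mul, Matrix.mul_neg, neg_neg, Matrix.smul_mul, Matrix.mul_assoc]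
      _ = _ := by
        rw [← e2, Matrix.mul_smul]
        simp only [Matrix.mul_assoc]
  rw [← Matrix.nonsing_inv_mul_cancel_left (T * V) (blockSwap n σ * companion A Cp Cm x t) hu, key,
    Matrix.nonsing_inv_mul_cancel_left _ _ hu]

/-- The diagonal entry at `lastIdx n 0` of the relation for K reads σ^n K₁₀ = -σ^(n+2) K₀₁*, with
K₀₁ taken at the reflected point and subscripts referring to the two last indices. -/
lemma wr_eq_reduction (hσ : σ = 1 ∨ σ = -1) (hA : IsUnit A.det) (hT : Constraint σ A T)
    (hC : Cm = T.mulVec (conjVec Cp)) {x t : ℝ} (h : (x, t) ∈ regularSet A Cp Cm) :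
    wr A Cp Cm x t = reduction σ (wq A Cp Cm) x t := by
  have h' := mem_regularSet_symm hσ hA hT hC h
  have e := congrFun (congrFun (blockSwap_mul_companion hσ hA hT hC h) (lastIdx n 0)) (lastIdx n 0)
  rw [Matrix.smul_apply, mul_blockSwap_apply_of_lt (j' := lastIdx n 1) _ _
    (by rw [lastIdx_val, lastIdx_val]; simp; omega), Matrix.mul_apply,
    Finset.sum_eq_single (lastIdx n 1)] at e
  · have hb : blockSwap n σ (lastIdx n 0) (lastIdx n 1) = (σ : ℂ) ^ n := by
      simp only [blockSwap, Matrix.of_apply, lastIdx_val]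
      simp
      omega
    have h0 : ((lastIdx n 0 : Fin _) : ℕ) = n := by rw [lastIdx_val]; simp
    rw [hb, h0, Matrix.map_apply, smul_eq_mul] at e
    have hσ0 : (σ : ℂ) ^ n ≠ 0 := pow_ne_zero _ (by rcases hσ with rfl | rfl <;> simp)
    have e' : companion A Cp Cm x t (lastIdx n 1) (lastIdx n 0) =
        -conj (companion A Cp Cm (σ * x) (σ * t) (lastIdx n 0) (lastIdx n 1)) := by
      refine mul_left_cancel₀ hσ0 ?_
      rw [e, pow_succ]
      linear_combination (-(σ : ℂ) ^ n *
        conj (companion A Cp Cm (σ * x) (σ * t) (lastIdx n 0) (lastIdx n 1))) *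
        sq_eq_one_of_sign hσ
    rw [wr_eq h, reduction, wq_eq h', lastBlock, lastBlock, Matrix.submatrix_apply,
      Matrix.submatrix_apply, e']
    simp only [map_mul, map_pow, map_neg, map_one, map_ofNat]
    ring
  · intro k _ hk
    have hk' := k.isLt
    have : blockSwap n σ (lastIdx n 0) k = 0 := by
      simp only [blockSwap, Matrix.of_apply, lastIdx_val, if_true]
      split_ifs with h1 h2 h3
      · omega
      · rfl
      · exact absurd (Fin.ext (by rw [lastIdx_val]; simp; omega)) hk
      · rfl
    rw [this, zero_mul]
  · simp

end Symmetry

/-- Complex reduction of the double Wronskian solutions. -/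
theorem wronskian_reduction {σ : ℝ} (hσ : σ = 1 ∨ σ = -1) {n : ℕ} {A T : Mat n} {Cp Cm : Vec n}
    (hA : IsUnit A.det) (hT : Constraint σ A T) (hC : Cm = T.mulVec (conjVec Cp)) :
    IsReducedSG σ (regularSet A Cp Cm) (wq A Cp Cm) (ws A Cp Cm) := by
  have hS := isSolution_wronskian (A := A) (Cp := Cp) (Cm := Cm) hA
  refine isReducedSG_of_eqs hS.smooth_q hS.differentiable_s hS.eq_q fun x t h => ?_
  rw [hS.eq_s x t h]
  -- The identity for r holds only where f ≠ 0; this set is open, so the t-derivatives still agree.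
  refine Filter.EventuallyEq.deriv_eq ?_
  filter_upwards [eventually_mem_snd isOpen_regularSet h] with τ hτ
  simp only [prod]
  rw [wr_eq_reduction hσ hA hT hC hτ]

/-- The equation s_x = (qr)_t determines s up to a function of t, which the limit 1/2 at both ends
fixes. -/
theorem wronskian_integral_form {n : ℕ} {A : Mat n} {Cp Cm : Vec n} (hA : IsUnit A.det)
    (hU : regularSet A Cp Cm = Set.univ)
    (hi : ∀ t, Integrable (fun x => dT (prod (wq A Cp Cm) (wr A Cp Cm)) x t))
    (hbot : ∀ t, Tendsto (fun x => ws A Cp Cm x t) atBot (𝓝 (1 / 2)))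
    (htop : ∀ t, Tendsto (fun x => ws A Cp Cm x t) atTop (𝓝 (1 / 2))) :
    IsIntegralSolution (wq A Cp Cm) (wr A Cp Cm) ∧
      ∀ x t, ws A Cp Cm x t =
        invDX (fun y => dT (prod (wq A Cp Cm) (wr A Cp Cm)) y t) x + 1 / 2 := by
  have hS := isSolution_wronskian (A := A) (Cp := Cp) (Cm := Cm) hA
  rw [hU] at hS
  have hs : ∀ x t, ws A Cp Cm x t =
      invDX (fun y => dT (prod (wq A Cp Cm) (wr A Cp Cm)) y t) x + 1 / 2 := fun x t => by
    refine invDX_eq_of_tendsto (u := fun x => ws A Cp Cm x t) (fun y => ?_) (hi t) (hbot t)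
      (htop t) x
    have := (hS.differentiable_s y t trivial).hasDerivAt
    exact this.congr_deriv (hS.eq_s y t trivial)
  exact ⟨(isIntegralSolution_iff_isSolution (contDiffOn_univ.1 hS.smooth_q)
    (contDiffOn_univ.1 hS.smooth_r) hi hs).2 hS, hs⟩

end AKNS

theorem theorem7 (σ : ℝ) (hσ : σ = 1 ∨ σ = -1) :
    -- the reduction of the system with auxiliary function `s`
    (∀ (Ω : Set (ℝ × ℝ)) (q s : ℝ → ℝ → ℂ), IsOpen Ω →
      (∀ x t, (x, t) ∈ Ω → (σ * x, σ * t) ∈ Ω) →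
      (AKNS.IsSolution Ω q (AKNS.reduction σ q) s → AKNS.IsReducedSG σ Ω q s) ∧
      ((∀ x t, (x, t) ∈ Ω → s (σ * x) (σ * t) = conj (s x t)) →
        AKNS.IsReducedSG σ Ω q s → AKNS.IsSolution Ω q (AKNS.reduction σ q) s)) ∧
    -- the reduction of the system in integral form
    (∀ q s : ℝ → ℝ → ℂ, ContDiff ℝ 2 (Function.uncurry q) →
      (∀ t, Integrable (fun x => AKNS.dT (AKNS.prod q (AKNS.reduction σ q)) x t)) →
      (∀ x t, s x t =
        AKNS.invDX (fun y => AKNS.dT (AKNS.prod q (AKNS.reduction σ q)) y t) x + 1 / 2) →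
      (∀ x t, s (σ * x) (σ * t) = conj (s x t)) ∧
      (AKNS.IsIntegralSolution q (AKNS.reduction σ q) ↔
        AKNS.IsSolution Set.univ q (AKNS.reduction σ q) s) ∧
      (AKNS.IsIntegralSolution q (AKNS.reduction σ q) ↔
        AKNS.IsReducedSG σ Set.univ q s)) ∧
    -- the double Wronskian solutions
    (∀ (n : ℕ) (A T : AKNS.Mat n) (Cp Cm : AKNS.Vec n), IsUnit A.det →
      AKNS.Constraint σ A T → Cm = T.mulVec (AKNS.conjVec Cp) →
      (∀ x t, AKNS.psi A Cm x t = T.mulVec (AKNS.conjVec (AKNS.phi A Cp (σ * x) (σ * t)))) ∧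
      IsOpen (AKNS.regularSet A Cp Cm) ∧
      (∀ x t, (x, t) ∈ AKNS.regularSet A Cp Cm →
        (σ * x, σ * t) ∈ AKNS.regularSet A Cp Cm ∧
        AKNS.wr A Cp Cm x t = AKNS.reduction σ (AKNS.wq A Cp Cm) x t ∧
        AKNS.ws A Cp Cm (σ * x) (σ * t) = conj (AKNS.ws A Cp Cm x t)) ∧
      AKNS.IsSolution (AKNS.regularSet A Cp Cm)
        (AKNS.wq A Cp Cm) (AKNS.wr A Cp Cm) (AKNS.ws A Cp Cm) ∧
      AKNS.IsReducedSG σ (AKNS.regularSet A Cp Cm) (AKNS.wq A Cp Cm) (AKNS.ws A Cp Cm) ∧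
      (AKNS.regularSet A Cp Cm = Set.univ →
        (∀ t, Integrable
          (fun x => AKNS.dT (AKNS.prod (AKNS.wq A Cp Cm) (AKNS.wr A Cp Cm)) x t)) →
        (∀ t, Tendsto (fun x => AKNS.ws A Cp Cm x t) atBot (𝓝 (1 / 2))) →
        (∀ t, Tendsto (fun x => AKNS.ws A Cp Cm x t) atTop (𝓝 (1 / 2))) →
        AKNS.IsIntegralSolution (AKNS.wq A Cp Cm) (AKNS.wr A Cp Cm) ∧
        ∀ x t, AKNS.ws A Cp Cm x t = AKNS.invDX
          (fun y => AKNS.dT (AKNS.prod (AKNS.wq A Cp Cm) (AKNS.wr A Cp Cm)) y t) x + 1 / 2)) ∧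
    -- explicit block matrices
    (∀ (n : ℕ) (K : Matrix (Fin (n + 1)) (Fin (n + 1)) ℂ),
      AKNS.Constraint σ (AKNS.blockA σ K) (AKNS.blockT n σ) ∧
      (IsUnit K.det → IsUnit (AKNS.blockA σ K).det)) ∧
    -- explicit `φ` for diagonal `K`
    (∀ (n : ℕ) (k c d : Fin (n + 1) → ℂ), (∀ j, k j ≠ 0) → ∀ x t : ℝ,
      AKNS.phi (AKNS.blockA σ (Matrix.diagonal k)) (Fin.append c d) x t =
        Fin.append (fun j => c j * Complex.exp (AKNS.mu (k j) x t))
          (fun j => d j * Complex.exp (AKNS.mu (-(σ : ℂ) * conj (k j)) x t))) ∧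
    -- explicit `φ` for a Jordan block `K`
    (∀ (n : ℕ) (k : ℂ) (c d : ℂ → ℂ), k ≠ 0 → AnalyticAt ℂ c k → AnalyticAt ℂ d (conj k) →
      ∀ x t : ℝ,
      AKNS.phi (AKNS.blockA σ (AKNS.jordan n k))
          (Fin.append (AKNS.jet n c k) (AKNS.jet n d (conj k))) x t =
        Fin.append (AKNS.jet n (fun κ => c κ * Complex.exp (AKNS.mu κ x t)) k)
          (AKNS.jet n (fun κ => d κ * Complex.exp (AKNS.mu (-(σ : ℂ) * κ) x t)) (conj k))) := by
  refine ⟨fun Ω q s _ hΩ => ⟨fun h => h.isReducedSG, fun hs h => h.isSolution hσ hΩ hs⟩,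
    fun q s hq hi hs => AKNS.integral_form hσ q s hq hi hs,
    fun n A T Cp Cm hA hT hC => ⟨AKNS.psi_eq_mulVec_conj_phi hσ hA hT hC, AKNS.isOpen_regularSet,
      fun x t h => ⟨AKNS.mem_regularSet_symm hσ hA hT hC h, AKNS.wr_eq_reduction hσ hA hT hC h,
        AKNS.ws_symm hσ hA hT hC h⟩,
      AKNS.isSolution_wronskian hA, AKNS.wronskian_reduction hσ hA hT hC,
      fun hU hi hbot htop => AKNS.wronskian_integral_form hA hU hi hbot htop⟩,
    fun n K => ⟨AKNS.constraint_blocks hσ K, fun hK => AKNS.isUnit_det_blockA hσ hK⟩,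
    fun n k c d hk x t => AKNS.phi_diagonal hσ k c d hk x t,
    fun n k c d hk hc hd x t => AKNS.phi_jordan hσ n hk hc hd x t⟩
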